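/- Let $\alpha,\beta>0$. Let $\mathcal F_{1,2,3}=\mathrm U(3)/\mathrm U(1)^3$ be the manifold of complete flags in $\mathbb C^3$, whose points are represented by orthonormal triples $(u_1,u_2,u_3)$ of vectors in $\mathbb C^3$, each $u_i$ being defined up to a phase. Write $\bar u\circ v$ for the standard Hermitian product, conjugate-linear in $u$. Equip $\mathcal F_{1,2,3}$ with the metric $$ds^2=\frac1\alpha\,|\bar u_1\circ du_2|^2+\frac1\beta\left(|\bar u_2\circ du_3|^2+|\bar u_1\circ du_3|^2\right).$$ A geodesic on an open interval is a smooth curve in $\mathcal F_{1,2,3}$ which, on each compact subinterval, is a critical point of the action $\int (ds/dt)^2\,dt$ for smooth variations with fixed endpoints. A smooth curve of orthonormal frames $u(t)=(u_1,u_2,u_3)(t)$ is called gauge-fixed if $\bar u_i\circ\dot u_i=0$ for $i=1,2,3$; put $A^0_{ij}:=\bar u_i(0)\circ\dot u_j(0)$. For complex numbers $A^0_{21},A^0_{31},A^0_{32}$ consider the formula $$\begin{pmatrix}u_1(t)\\u_2(t)\\u_3(t)\end{pmatrix}=G(t)\,\exp\left[\begin{pmatrix}0&\frac1\alpha A^0_{21}&\frac1\beta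 A^0_{31}\\-\frac1\alpha\bar A^0_{21}&0&\frac1\beta A^0_{32}\\-\frac1\beta\bar A^0_{31}&-\frac1\beta\bar A^0_{32}&0\end{pmatrix}\beta t\right]\begin{pmatrix}u_1(0)\\u_2(0)\\u_3(0)\end{pmatrix},\qquad(*)$$ $$G(t)=\begin{pmatrix}\exp\left[\begin{pmatrix}0&\frac1\alpha A^0_{21}\\-\frac1\alpha\bar A^0_{21}&0\end{pmatrix}(\alpha-\beta)t\right]&\\&1\end{pmatrix},$$ where the $3\times3$ matrices act on the column whose entries are the vectors $u_1,u_2,u_3$. Then $(*)$ is the general solution of the geodesic equations. That is, for every open interval $I\ni0$: (1) for every geodesic $c$ on $I$ and every orthonormal frame $u^0$ representing $c(0)$, there is a gauge-fixed smooth curve of frames $u$ on $I$ with $u(0)=u^0$ that represents $c$, and it satisfies $(*)$ on $I$, with $A^0_{ij}=\bar u_i(0)\circ\dot u_j(0)$; (2) a gauge-fixed smooth curve of frames $u$ on $I$ represents a geodesic if and only if it satisfies $(*)$ on $I$ with $A^0_{ij}=\bar u_i(0)\circ\dot u_j(0)$; (3) for every orthonormal frame $(u_1(0),u_2(0),u_3(0))$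 and all $A^0_{21},A^0_{31},A^0_{32}\in\mathbb C$, formula $(*)$ defines, for all $t\in\mathbb R$, a gauge-fixed smooth curve of orthonormal frames with initial data $\bar u_i(0)\circ\dot u_j(0)=A^0_{ij}$ for $(i,j)=(2,1),(3,1),(3,2)$, and this curve represents a geodesic on $\mathbb R$. -/

import Mathlib

open Set
open scoped ContDiff ComplexConjugate

/-- Orthonormal triples `(u₁, u₂, u₃)` of vectors of `ℂ³` (indexed from `0` in Lean), i.e. `U(3)`. -/
abbrev UnitaryFrame : Type :=
  {u : Fin 3 → EuclideanSpace ℂ (Fin 3) // Orthonormal ℂ u}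

/-- Two frames are identified when their vectors agree up to phase factors. -/
instance phaseSetoid : Setoid UnitaryFrame where
  r u v := ∃ φ : Fin 3 → Circle, ∀ i, v.1 i = (φ i : ℂ) • u.1 i
  iseqv :=
    { refl := fun u => ⟨fun _ => 1, fun i => by simp⟩
      symm := by
        rintro u v ⟨φ, h⟩
        refine ⟨fun i => (φ i)⁻¹, fun i => ?_⟩
        rw [h i, smul_smul, ← Circle.coe_mul, inv_mul_cancel, Circle.coe_one, one_smul]
      trans := by
        rintro u v w ⟨φ, h⟩ ⟨ψ, k⟩
        refine ⟨fun i => ψ i * φ i, fun i => ?_⟩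
        rw [k i, h i, smul_smul, Circle.coe_mul] }

/-- The manifold of complete flags in `ℂ³`, as the quotient `U(3) / U(1)³`. -/
abbrev FlagManifold : Type := Quotient phaseSetoid

/-- The point of the flag manifold represented by a frame. -/
def UnitaryFrame.toFlag (u : UnitaryFrame) : FlagManifold := Quotient.mk phaseSetoid u

/-- The quadratic form
`|ū₁ ∘ du₂|² / α + |ū₂ ∘ du₃|² / β + |ū₁ ∘ du₃|² / γ`
at the frame `u`, on the velocity `v` of the frame. -/
noncomputable def flagMetric (α β γ : ℝ) (u v : Fin 3 → EuclideanSpace ℂ (Fin 3)) : ℝ :=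
  1 / α * ‖inner ℂ (u 0) (v 1)‖ ^ 2 + 1 / β * ‖inner ℂ (u 1) (v 2)‖ ^ 2
    + 1 / γ * ‖inner ℂ (u 0) (v 2)‖ ^ 2

/-- The quadratic form is unchanged under `u ↦ φ u`, `du ↦ φ du + κ u` with phases `φ`
(the effect of an arbitrary `U(1)³` gauge transformation), so it is a form on the quotient. -/
theorem flagMetric_gauge (α β γ : ℝ) (u : UnitaryFrame) (v : Fin 3 → EuclideanSpace ℂ (Fin 3))
    (φ : Fin 3 → Circle) (κ : Fin 3 → ℂ) :
    flagMetric α β γ (fun i => (φ i : ℂ) • u.1 i) (fun i => (φ i : ℂ) • v i + κ i • u.1 i)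
      = flagMetric α β γ u.1 v := by
  have h : ∀ i j, i ≠ j → inner ℂ (u.1 i) (u.1 j) = 0 := fun i j hij => u.2.2 hij
  have k : ∀ i j, i ≠ j →
      ‖inner ℂ ((φ i : ℂ) • u.1 i) ((φ j : ℂ) • v j + κ j • u.1 j)‖ = ‖inner ℂ (u.1 i) (v j)‖ := by
    intro i j hij
    rw [inner_add_right, inner_smul_right, inner_smul_right, inner_smul_left, inner_smul_left,
      h i j hij, mul_zero, mul_zero, add_zero, norm_mul, norm_mul, RCLike.norm_conj,
      Circle.norm_coe, Circle.norm_coe, one_mul, one_mul]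
  rw [flagMetric, flagMetric, k 0 1 (by decide), k 1 2 (by decide), k 0 2 (by decide)]

/-- Smooth curves in the quotient: those that near each time lift to a smooth curve of frames. -/
def IsSmoothFlagCurveOn (c : ℝ → FlagManifold) (I : Set ℝ) : Prop :=
  ∀ t₀ ∈ I, ∃ J : Set ℝ, IsOpen J ∧ t₀ ∈ J ∧ ∃ u : ℝ → UnitaryFrame,
    ContDiffOn ℝ ∞ (fun t => (u t).1) (J ∩ I) ∧ ∀ t ∈ J ∩ I, (u t).toFlag = c t

/-- The action (energy) `∫ ds²/dt² dt` over `[a, b]` of the curve in the flag manifold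
represented by the curve of frames `u`. -/
noncomputable def flagAction (α β γ a b : ℝ) (u : ℝ → UnitaryFrame) : ℝ :=
  ∫ t in a..b, flagMetric α β γ (u t).1 (derivWithin (fun τ => (u τ).1) (Icc a b) t)

/-- `V` represents a smooth variation, with fixed endpoints, of the restriction of `c` to `[a, b]`;
`s ∈ (-ε, ε)` is the parameter of the variation. (Rectangles are contractible, so every smooth map
from a rectangle to the flag manifold lifts to a smooth map to frames.) -/
structure IsFlagVariation (c : ℝ → FlagManifold) (a b ε : ℝ) (V : ℝ → ℝ → UnitaryFrame) :
    Prop where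
  smooth : ContDiffOn ℝ ∞ (fun p : ℝ × ℝ => (V p.1 p.2).1) (Ioo (-ε) ε ×ˢ Icc a b)
  base : ∀ t ∈ Icc a b, (V 0 t).toFlag = c t
  left : ∀ s ∈ Ioo (-ε) ε, (V s a).toFlag = c a
  right : ∀ s ∈ Ioo (-ε) ε, (V s b).toFlag = c b

/-- Geodesics of the metric with parameters `α, β, γ` on an interval `I`: smooth curves that are
critical points of the action on each compact subinterval, for variations with fixed endpoints. -/
def IsFlagGeodesicOn (α β γ : ℝ) (c : ℝ → FlagManifold) (I : Set ℝ) : Prop :=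
  IsSmoothFlagCurveOn c I ∧
    ∀ a b : ℝ, a < b → Icc a b ⊆ I → ∀ ε : ℝ, 0 < ε → ∀ V : ℝ → ℝ → UnitaryFrame,
      IsFlagVariation c a b ε V → HasDerivAt (fun s => flagAction α β γ a b (V s)) 0 0

/-- `A i j t = ūᵢ(t) ∘ u̇ⱼ(t)`. -/
noncomputable def frameVelocity (u : ℝ → UnitaryFrame) (i j : Fin 3) (t : ℝ) : ℂ :=
  inner ℂ ((u t).1 i) (deriv (fun τ => (u τ).1 j) t)

/-- A smooth curve of frames on `I` in the gauge `ūᵢ ∘ u̇ᵢ = 0`. -/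
structure IsGaugeFixedOn (u : ℝ → UnitaryFrame) (I : Set ℝ) : Prop where
  smooth : ContDiffOn ℝ ∞ (fun t => (u t).1) I
  gauge : ∀ t ∈ I, ∀ i, frameVelocity u i i t = 0

/-- The constant skew-Hermitian generator. -/
noncomputable def geodesicGenerator (α β : ℝ) (a₂₁ a₃₁ a₃₂ : ℂ) : Matrix (Fin 3) (Fin 3) ℂ :=
  !![0, 1 / (α : ℂ) * a₂₁, 1 / (β : ℂ) * a₃₁;
    -(1 / (α : ℂ)) * conj a₂₁, 0, 1 / (β : ℂ) * a₃₂;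
    -(1 / (β : ℂ)) * conj a₃₁, -(1 / (β : ℂ)) * conj a₃₂, 0]

/-- The `2 × 2` exponential with time factor `(α - β) t`. -/
noncomputable def geodesicBlock (α β : ℝ) (a₂₁ : ℂ) (t : ℝ) : Matrix (Fin 2) (Fin 2) ℂ :=
  NormedSpace.exp ((((α - β) * t : ℝ) : ℂ) •
    !![0, 1 / (α : ℂ) * a₂₁;
      -(1 / (α : ℂ)) * conj a₂₁, 0])

/-- The block-diagonal matrix `G(t)`. -/
noncomputable def geodesicG (α β : ℝ) (a₂₁ : ℂ) (t : ℝ) : Matrix (Fin 3) (Fin 3) ℂ :=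
  !![geodesicBlock α β a₂₁ t 0 0, geodesicBlock α β a₂₁ t 0 1, 0;
    geodesicBlock α β a₂₁ t 1 0, geodesicBlock α β a₂₁ t 1 1, 0;
    0, 0, 1]

/-- The triple of vectors `G(t) exp(β t M) (u₁, u₂, u₃)ᵀ`, where the matrix acts on the column
with entries the vectors `u₁, u₂, u₃`. -/
noncomputable def geodesicFormula (α β : ℝ) (a₂₁ a₃₁ a₃₂ : ℂ)
    (u : Fin 3 → EuclideanSpace ℂ (Fin 3)) (t : ℝ) : Fin 3 → EuclideanSpace ℂ (Fin 3) :=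
  fun i => ∑ j, (geodesicG α β a₂₁ t *
    NormedSpace.exp (((β * t : ℝ) : ℂ) • geodesicGenerator α β a₂₁ a₃₁ a₃₂)) i j • u j

/-! Write a frame as the unitary matrix `U` with its vectors as rows and put Ω = U̇ U*. Then `ūᵢ ∘
u̇ⱼ` is the `(j, i)` entry of Ω, and gauge fixing means that Ω has zero diagonal. Let Λ be
`flagInertia`. The energy density is -½ Re tr(Λ(Ω) Ω), which time-dependent phases do not change
(`flagKinetic_gauge`).

For a variation with field C = ∂ₛU U*, the identity ∂ₛΩ = ∂ₜC + [C, Ω]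
(`stripDerivLeft_stripVelocity`) and integration by parts give the Euler-Lagrange equation Λ(Ω̇) =
[Ω, Λ(Ω)]. The boundary terms vanish: flags fixed at the endpoints make C diagonal there, and Λ(Ω)
has zero diagonal. Necessity comes from the variations exp(s η(t) X) U(t) and the fundamental lemma
of the calculus of variations (`IsFlagGeodesicOn.eulerDefect_eq_zero`), sufficiency from
`isFlagGeodesicOn_of_eulerDefect`.

The equation is integrable because two of the three coefficients agree. In the gauge, the `(0, 1)`
entry of [Ω, Λ(Ω)] cancels, so that entry of Ω is constant. Hence Ω = b + β Λ(Ω), where b is the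
constant matrix 1 - β/α times the upper block of Ω, and the momentum obeys the linear equation Λ(Ω)˙
= [b, Λ(Ω)]. So Λ(Ω(t)) = P M P* with P = exp(t b) and M the initial momentum
(`bodyVelocity_of_eulerDefect`). The curve P exp(β t M) U(0) has exactly the velocity b + β P M P*,
and P is the matrix `G` of the formula; a unitary curve is determined by its velocity and initial
value (`eqOn_of_same_velocity`).

Gauge-fixed lifts exist locally by integrating phases, are unique given one value, and glue along
the interval by connectedness (`IsSmoothFlagCurveOn.exists_lift`). -/

/-! ### Calculus on the rectangle of a variation. -/

section Strip

variable {F : Type*} [NormedAddCommGroup F] [NormedSpace ℝ F]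

/-- The parameter rectangle of a variation. -/
abbrev strip (ε a b : ℝ) : Set (ℝ × ℝ) := Ioo (-ε) ε ×ˢ Icc a b

/-- Derivative along the variation parameter. -/
noncomputable def stripDerivLeft (ε a b : ℝ) (f : ℝ × ℝ → F) (p : ℝ × ℝ) : F :=
  fderivWithin ℝ f (strip ε a b) p (1, 0)

/-- Derivative along the curve parameter. -/
noncomputable def stripDerivRight (ε a b : ℝ) (f : ℝ × ℝ → F) (p : ℝ × ℝ) : F :=
  fderivWithin ℝ f (strip ε a b) p (0, 1)

theorem uniqueDiffOn_strip {ε a b : ℝ} (hab : a < b) : UniqueDiffOn ℝ (strip ε a b) :=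
  isOpen_Ioo.uniqueDiffOn.prod (uniqueDiffOn_Icc hab)

theorem ContDiffOn.stripDerivLeft {ε a b : ℝ} {f : ℝ × ℝ → F} (hab : a < b)
    (hf : ContDiffOn ℝ ∞ f (strip ε a b)) :
    ContDiffOn ℝ ∞ (stripDerivLeft ε a b f) (strip ε a b) :=
  (hf.fderivWithin (uniqueDiffOn_strip hab) (m := ∞) (by simp)).clm_apply contDiffOn_const

theorem ContDiffOn.stripDerivRight {ε a b : ℝ} {f : ℝ × ℝ → F} (hab : a < b)
    (hf : ContDiffOn ℝ ∞ f (strip ε a b)) :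
    ContDiffOn ℝ ∞ (stripDerivRight ε a b f) (strip ε a b) :=
  (hf.fderivWithin (uniqueDiffOn_strip hab) (m := ∞) (by simp)).clm_apply contDiffOn_const

theorem hasDerivAt_stripDerivLeft {ε a b s t : ℝ} {f : ℝ × ℝ → F}
    (hf : ContDiffOn ℝ ∞ f (strip ε a b)) (hs : s ∈ Ioo (-ε) ε) (ht : t ∈ Icc a b) :
    HasDerivAt (fun σ => f (σ, t)) (stripDerivLeft ε a b f (s, t)) s := by
  have h := (hf.differentiableOn (by simp) (s, t) ⟨hs, ht⟩).hasFDerivWithinAt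
  have hg : HasDerivWithinAt (fun σ : ℝ => (σ, t)) (1, 0) (Ioo (-ε) ε) s :=
    (hasDerivWithinAt_id s _).prodMk (hasDerivWithinAt_const s _ t)
  exact (h.comp_hasDerivWithinAt s hg fun σ (hσ : σ ∈ Ioo (-ε) ε) =>
    (⟨hσ, ht⟩ : (σ, t) ∈ strip ε a b)).hasDerivAt
    (isOpen_Ioo.mem_nhds hs)

theorem hasDerivWithinAt_stripDerivRight {ε a b s t : ℝ} {f : ℝ × ℝ → F}
    (hf : ContDiffOn ℝ ∞ f (strip ε a b)) (hs : s ∈ Ioo (-ε) ε) (ht : t ∈ Icc a b) :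
    HasDerivWithinAt (fun τ => f (s, τ)) (stripDerivRight ε a b f (s, t)) (Icc a b) t := by
  have h := (hf.differentiableOn (by simp) (s, t) ⟨hs, ht⟩).hasFDerivWithinAt
  have hg : HasDerivWithinAt (fun τ : ℝ => (s, τ)) (0, 1) (Icc a b) t :=
    (hasDerivWithinAt_const t _ s).prodMk (hasDerivWithinAt_id t _)
  exact h.comp_hasDerivWithinAt t hg fun τ (hτ : τ ∈ Icc a b) =>
    (⟨hs, hτ⟩ : (s, τ) ∈ strip ε a b)

theorem stripDerivLeft_stripDerivRight {ε a b : ℝ} {f : ℝ × ℝ → F} (hab : a < b)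
    (hf : ContDiffOn ℝ ∞ f (strip ε a b)) {p : ℝ × ℝ} (hp : p ∈ strip ε a b) :
    stripDerivLeft ε a b (stripDerivRight ε a b f) p
      = stripDerivRight ε a b (stripDerivLeft ε a b f) p := by
  have hu := uniqueDiffOn_strip (ε := ε) hab
  have hd : DifferentiableWithinAt ℝ (fderivWithin ℝ f (strip ε a b)) (strip ε a b) p :=
    (hf.fderivWithin hu (m := ∞) (by simp)).differentiableOn (by simp) p hp
  have key : ∀ v w : ℝ × ℝ,
      fderivWithin ℝ (fun q => fderivWithin ℝ f (strip ε a b) q v) (strip ε a b) p w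
        = fderivWithin ℝ (fderivWithin ℝ f (strip ε a b)) (strip ε a b) p w v := by
    intro v w
    rw [fderivWithin_clm_apply (hu p hp) hd (differentiableWithinAt_const v)]
    simp
  -- Second derivatives within a set are symmetric at limits of interior points; this covers the
  -- edges t = a and t = b.
  have hcl : p ∈ closure (interior (strip ε a b)) := by
    rw [strip, interior_prod_eq, closure_prod_eq, interior_Icc, closure_Ioo hab.ne,
      isOpen_Ioo.interior_eq]
    exact ⟨subset_closure hp.1, hp.2⟩
  have hsymm := (hf p hp).isSymmSndFDerivWithinAt
    (by simpa using WithTop.coe_le_coe.2 (le_top : (2 : ℕ∞) ≤ ⊤)) hu hcl hp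
  unfold stripDerivLeft stripDerivRight
  rw [key, key]
  exact hsymm _ _

theorem ContDiffOn.slice {ε a b s : ℝ} {f : ℝ × ℝ → F}
    (hf : ContDiffOn ℝ ∞ f (strip ε a b)) (hs : s ∈ Ioo (-ε) ε) :
    ContDiffOn ℝ ∞ (fun t => f (s, t)) (Icc a b) :=
  hf.comp (contDiff_const.prodMk contDiff_id).contDiffOn fun _ ht => ⟨hs, ht⟩

theorem hasDerivAt_integral_strip [CompleteSpace F] {ε a b : ℝ} {f : ℝ × ℝ → F} (hab : a < b)
    (hε : 0 < ε) (hf : ContDiffOn ℝ ∞ f (strip ε a b)) :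
    HasDerivAt (fun s => ∫ t in a..b, f (s, t))
      (∫ t in a..b, stripDerivLeft ε a b f (0, t)) 0 := by
  -- Halving ε gives a compact rectangle, on which the derivative in s has a uniform bound to serve
  -- as dominating function.
  have hsub : Icc (-(ε / 2)) (ε / 2) ⊆ Ioo (-ε) ε := fun x hx =>
    ⟨by linarith [hx.1], by linarith [hx.2]⟩
  have hcomp : IsCompact (Icc (-(ε / 2)) (ε / 2) ×ˢ Icc a b) := isCompact_Icc.prod isCompact_Icc
  have hD := hf.stripDerivLeft hab
  obtain ⟨C, hC⟩ := hcomp.exists_bound_of_continuousOn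
    (hD.continuousOn.mono (prod_mono hsub Subset.rfl))
  have h0 : (0 : ℝ) ∈ Ioo (-ε) ε := ⟨by linarith, hε⟩
  have hIoc : uIoc a b ⊆ Icc a b := by rw [uIoc_of_le hab.le]; exact Ioc_subset_Icc_self
  have hmeas : ∀ {g : ℝ → F}, ContinuousOn g (Icc a b) →
      MeasureTheory.AEStronglyMeasurable g (MeasureTheory.volume.restrict (uIoc a b)) :=
    fun hg => (hg.mono hIoc).aestronglyMeasurable measurableSet_uIoc
  have hs : Icc (-(ε / 2)) (ε / 2) ∈ nhds (0 : ℝ) := Icc_mem_nhds (by linarith) (by linarith)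
  refine (intervalIntegral.hasDerivAt_integral_of_dominated_loc_of_deriv_le
    (F := fun s t => f (s, t)) (F' := fun s t => stripDerivLeft ε a b f (s, t))
    (bound := fun _ => C) hs ?_ ?_ ?_ ?_ ?_ ?_).2
  · filter_upwards [hs] with s hs
    exact hmeas (hf.slice (hsub hs)).continuousOn
  · exact ContinuousOn.intervalIntegrable (by
      rw [uIcc_of_le hab.le]; exact (hf.slice h0).continuousOn)
  · exact hmeas (hD.slice h0).continuousOn
  · exact Filter.Eventually.of_forall fun t ht s hs => hC (s, t) ⟨hs, hIoc ht⟩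
  · exact intervalIntegrable_const
  · exact Filter.Eventually.of_forall fun t ht s hs =>
      hasDerivAt_stripDerivLeft hf (hsub hs) (hIoc ht)

end Strip

/-! ### Kinetic energy on matrices and the first variation formula. -/

section FirstVariation

attribute [local instance] Matrix.linftyOpNormedRing Matrix.linftyOpNormedAlgebra

/-- Complex `3 × 3` matrices. -/
abbrev CMat : Type := Matrix (Fin 3) (Fin 3) ℂ

/-- The operator norm makes matrices a normed algebra, as products and exponentials require. Its
topology is definitionally the entrywise one, so continuity of the adjoint carries over. -/
theorem continuousStar_linftyOp :
    @ContinuousStar CMat (Matrix.linftyOpNormedRing (n := Fin 3)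
      (α := ℂ)).toMetricSpace.toUniformSpace.toTopologicalSpace _ :=
  inferInstanceAs (ContinuousStar (Matrix (Fin 3) (Fin 3) ℂ))

attribute [local instance] continuousStar_linftyOp

/-- The real part of the trace. -/
noncomputable def reTrace : CMat →L[ℝ] ℝ :=
  LinearMap.toContinuousLinearMap
    { toFun := fun X => X.trace.re
      map_add' := fun X Y => by simp [Matrix.trace_add]
      map_smul' := fun r X => by simp [Matrix.trace_smul] }

theorem reTrace_apply (X : CMat) : reTrace X = X.trace.re := rfl

theorem reTrace_mul_comm (X Y : CMat) : reTrace (X * Y) = reTrace (Y * X) := by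
  rw [reTrace_apply, reTrace_apply, Matrix.trace_mul_comm]

/-- The inertia operator of the metric: the off-diagonal entries are divided by `α` or `β`. -/
noncomputable def flagInertia (α β : ℝ) : CMat →L[ℝ] CMat :=
  LinearMap.toContinuousLinearMap
    { toFun := fun X => !![0, 1 / (α : ℂ) * X 0 1, 1 / (β : ℂ) * X 0 2;
        1 / (α : ℂ) * X 1 0, 0, 1 / (β : ℂ) * X 1 2;
        1 / (β : ℂ) * X 2 0, 1 / (β : ℂ) * X 2 1, 0]
      map_add' := fun X Y => by
        ext i j; fin_cases i <;> fin_cases j <;> simp [mul_add]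
      map_smul' := fun r X => by
        ext i j; fin_cases i <;> fin_cases j <;> simp [mul_left_comm] }

theorem flagInertia_apply (α β : ℝ) (X : CMat) :
    flagInertia α β X = !![0, 1 / (α : ℂ) * X 0 1, 1 / (β : ℂ) * X 0 2;
        1 / (α : ℂ) * X 1 0, 0, 1 / (β : ℂ) * X 1 2;
        1 / (β : ℂ) * X 2 0, 1 / (β : ℂ) * X 2 1, 0] := rfl

/-- The coefficient attached to the entry `(i, j)` is symmetric in i and j, which makes the inertia
operator self-adjoint for the trace pairing. -/
theorem reTrace_flagInertia_mul (α β : ℝ) (X Y : CMat) :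
    reTrace (flagInertia α β X * Y) = reTrace (X * flagInertia α β Y) := by
  rw [reTrace_apply, reTrace_apply]
  congr 1
  simp only [Matrix.trace, Matrix.diag_apply, Fin.sum_univ_three, Matrix.mul_apply,
    flagInertia_apply]
  simp
  ring

/-- The kinetic form of a skew-Hermitian velocity. -/
noncomputable def flagKinetic (α β : ℝ) (X : CMat) : ℝ :=
  -(1 / 2) * reTrace (flagInertia α β X * X)

/-- The defect in the Euler-Lagrange equation of a velocity `B` with time derivative `B'`. -/
noncomputable def eulerDefect (α β : ℝ) (B B' : CMat) : CMat :=
  flagInertia α β B' - (B * flagInertia α β B - flagInertia α β B * B)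

/-- Self-adjointness of the inertia makes the two terms of the product rule equal, which cancels the
factor 1/2. -/
theorem HasDerivAt.flagKinetic {α β : ℝ} {B : ℝ → CMat} {B' : CMat} {s : ℝ}
    (h : HasDerivAt B B' s) :
    HasDerivAt (fun σ => flagKinetic α β (B σ)) (-reTrace (flagInertia α β (B s) * B')) s := by
  have h1 : HasDerivAt (fun σ => flagInertia α β (B σ)) (flagInertia α β B') s :=
    (flagInertia α β).hasFDerivAt.comp_hasDerivAt s h
  have h2 := (reTrace.hasFDerivAt.comp_hasDerivAt s (h1.mul h)).const_mul (-(1 / 2) : ℝ)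
  have h3 : -(1 / 2) * reTrace (flagInertia α β B' * B s + flagInertia α β (B s) * B')
      = -reTrace (flagInertia α β (B s) * B') := by
    rw [map_add, reTrace_flagInertia_mul, reTrace_mul_comm]
    ring
  exact h2.congr_deriv h3

theorem ContDiffOn.flagKinetic {E : Type*} [NormedAddCommGroup E] [NormedSpace ℝ E] {α β : ℝ}
    {B : E → CMat} {S : Set E} (h : ContDiffOn ℝ ∞ B S) :
    ContDiffOn ℝ ∞ (fun p => flagKinetic α β (B p)) S :=
  contDiffOn_const.mul (reTrace.contDiff.comp_contDiffOn
    (((flagInertia α β).contDiff.comp_contDiffOn h).mul h))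

theorem ContDiffOn.matrix_star {E : Type*} [NormedAddCommGroup E] [NormedSpace ℝ E]
    {f : E → CMat} {S : Set E} (h : ContDiffOn ℝ ∞ f S) :
    ContDiffOn ℝ ∞ (fun p => star (f p)) S :=
  (starL' ℝ (A := CMat)).contDiff.comp_contDiffOn h

variable {ε a b : ℝ}

theorem stripDerivLeft_mul_star {g h : ℝ × ℝ → CMat}
    (hg : ContDiffOn ℝ ∞ g (strip ε a b)) (hh : ContDiffOn ℝ ∞ h (strip ε a b))
    {p : ℝ × ℝ} (hp : p ∈ strip ε a b) :
    stripDerivLeft ε a b (fun q => g q * star (h q)) p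
      = stripDerivLeft ε a b g p * star (h p) + g p * star (stripDerivLeft ε a b h p) :=
  (hasDerivAt_stripDerivLeft (hg.mul hh.matrix_star) hp.1 hp.2).unique
    ((hasDerivAt_stripDerivLeft hg hp.1 hp.2).mul (hasDerivAt_stripDerivLeft hh hp.1 hp.2).star)

theorem stripDerivRight_mul_star (hab : a < b) {g h : ℝ × ℝ → CMat}
    (hg : ContDiffOn ℝ ∞ g (strip ε a b)) (hh : ContDiffOn ℝ ∞ h (strip ε a b))
    {p : ℝ × ℝ} (hp : p ∈ strip ε a b) :
    stripDerivRight ε a b (fun q => g q * star (h q)) p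
      = stripDerivRight ε a b g p * star (h p) + g p * star (stripDerivRight ε a b h p) :=
  (uniqueDiffOn_Icc hab p.2 hp.2).eq_deriv _
    (hasDerivWithinAt_stripDerivRight (hg.mul hh.matrix_star) hp.1 hp.2)
    ((hasDerivWithinAt_stripDerivRight hg hp.1 hp.2).mul
      (hasDerivWithinAt_stripDerivRight hh hp.1 hp.2).star)

/-- The velocity `∂ₜf f*` of a family of unitary matrices. -/
noncomputable def stripVelocity (ε a b : ℝ) (f : ℝ × ℝ → CMat) (p : ℝ × ℝ) : CMat :=
  stripDerivRight ε a b f p * star (f p)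

/-- The variation field `∂ₛf f*` of a family of unitary matrices. -/
noncomputable def stripField (ε a b : ℝ) (f : ℝ × ℝ → CMat) (p : ℝ × ℝ) : CMat :=
  stripDerivLeft ε a b f p * star (f p)

theorem ContDiffOn.stripVelocity (hab : a < b) {f : ℝ × ℝ → CMat}
    (hf : ContDiffOn ℝ ∞ f (strip ε a b)) :
    ContDiffOn ℝ ∞ (stripVelocity ε a b f) (strip ε a b) :=
  (hf.stripDerivRight hab).mul hf.matrix_star

theorem ContDiffOn.stripField (hab : a < b) {f : ℝ × ℝ → CMat}
    (hf : ContDiffOn ℝ ∞ f (strip ε a b)) :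
    ContDiffOn ℝ ∞ (stripField ε a b f) (strip ε a b) :=
  (hf.stripDerivLeft hab).mul hf.matrix_star

/-- The logarithmic derivative `v u*` of a unitary family is skew-Hermitian. -/
theorem mul_star_skew {u v : CMat} (h : v * star u + u * star v = 0) :
    star (v * star u) = -(v * star u) := by
  rw [star_mul, star_star]
  exact eq_neg_of_add_eq_zero_right h

theorem stripVelocity_skew (hab : a < b) {f : ℝ × ℝ → CMat}
    (hf : ContDiffOn ℝ ∞ f (strip ε a b)) (hu : ∀ p ∈ strip ε a b, f p * star (f p) = 1)
    {p : ℝ × ℝ} (hp : p ∈ strip ε a b) :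
    star (stripVelocity ε a b f p) = -stripVelocity ε a b f p := by
  refine mul_star_skew ?_
  rw [← stripDerivRight_mul_star hab hf hf hp]
  refine (uniqueDiffOn_Icc hab p.2 hp.2).eq_deriv _
    (hasDerivWithinAt_stripDerivRight (hf.mul hf.matrix_star) hp.1 hp.2)
    ((hasDerivWithinAt_const p.2 _ (1 : CMat)).congr (fun t ht => hu _ ⟨hp.1, ht⟩) (hu _ hp))

theorem stripField_skew {f : ℝ × ℝ → CMat}
    (hf : ContDiffOn ℝ ∞ f (strip ε a b)) (hu : ∀ p ∈ strip ε a b, f p * star (f p) = 1)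
    {p : ℝ × ℝ} (hp : p ∈ strip ε a b) :
    star (stripField ε a b f p) = -stripField ε a b f p := by
  refine mul_star_skew ?_
  rw [← stripDerivLeft_mul_star hf hf hp]
  refine (hasDerivAt_stripDerivLeft (hf.mul hf.matrix_star) hp.1 hp.2).unique
    ((hasDerivAt_const p.1 (1 : CMat)).congr_of_eventuallyEq ?_)
  filter_upwards [isOpen_Ioo.mem_nhds hp.1] with s hs
  exact hu _ ⟨hs, hp.2⟩

/-- This is the zero-curvature (Maurer-Cartan) identity: mixed partial derivatives of `f` agree, so
only the terms in which the derivative falls on f* survive, and they form the commutator. -/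
theorem stripDerivLeft_stripVelocity (hab : a < b) {f : ℝ × ℝ → CMat}
    (hf : ContDiffOn ℝ ∞ f (strip ε a b)) (hu : ∀ p ∈ strip ε a b, f p * star (f p) = 1)
    {p : ℝ × ℝ} (hp : p ∈ strip ε a b) :
    stripDerivLeft ε a b (stripVelocity ε a b f) p
      = stripDerivRight ε a b (stripField ε a b f) p
        + (stripField ε a b f p * stripVelocity ε a b f p
          - stripVelocity ε a b f p * stripField ε a b f p) := by
  have hu' : star (f p) * f p = 1 := mul_eq_one_comm.1 (hu p hp)
  have hB := stripVelocity_skew hab hf hu hp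
  have hC := stripField_skew hf hu hp
  -- Inserting f* f = 1 expresses products of derivatives through logarithmic derivatives.
  have key : ∀ v w : CMat, v * star w = (v * star (f p)) * star (w * star (f p)) := by
    intro v w
    rw [star_mul, star_star, mul_assoc, ← mul_assoc (star (f p)), hu', one_mul]
  have e1 : stripDerivLeft ε a b (stripVelocity ε a b f) p
      = stripDerivLeft ε a b (stripDerivRight ε a b f) p * star (f p)
        + stripDerivRight ε a b f p * star (stripDerivLeft ε a b f p) :=
    stripDerivLeft_mul_star (hf.stripDerivRight hab) hf hp
  have e2 : stripDerivRight ε a b (stripField ε a b f) p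
      = stripDerivRight ε a b (stripDerivLeft ε a b f) p * star (f p)
        + stripDerivLeft ε a b f p * star (stripDerivRight ε a b f p) :=
    stripDerivRight_mul_star hab (hf.stripDerivLeft hab) hf hp
  have e3 : stripDerivRight ε a b f p * star (stripDerivLeft ε a b f p)
      = -(stripVelocity ε a b f p * stripField ε a b f p) := by
    rw [key, ← stripVelocity, ← stripField, hC, mul_neg]
  have e4 : stripDerivLeft ε a b f p * star (stripDerivRight ε a b f p)
      = -(stripField ε a b f p * stripVelocity ε a b f p) := by
    rw [key, ← stripVelocity, ← stripField, hB, mul_neg]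
  rw [e1, e2, e3, e4, stripDerivLeft_stripDerivRight hab hf hp]
  abel

/-- The first variation of the action. -/
theorem hasDerivAt_integral_flagKinetic (α β : ℝ) (hab : a < b) (hε : 0 < ε) {f : ℝ × ℝ → CMat}
    (hf : ContDiffOn ℝ ∞ f (strip ε a b)) (hu : ∀ p ∈ strip ε a b, f p * star (f p) = 1) :
    HasDerivAt (fun s => ∫ t in a..b, flagKinetic α β (stripVelocity ε a b f (s, t)))
      ((∫ t in a..b, reTrace (stripField ε a b f (0, t) *
          eulerDefect α β (stripVelocity ε a b f (0, t))
            (stripDerivRight ε a b (stripVelocity ε a b f) (0, t))))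
        - (reTrace (flagInertia α β (stripVelocity ε a b f (0, b)) * stripField ε a b f (0, b))
          - reTrace (flagInertia α β (stripVelocity ε a b f (0, a)) * stripField ε a b f (0, a))))
      0 := by
  have h0 : (0 : ℝ) ∈ Ioo (-ε) ε := ⟨by linarith, hε⟩
  have hBs := hf.stripVelocity hab
  have hCs := hf.stripField hab
  have hB's := hBs.stripDerivRight hab
  have hC's := hCs.stripDerivRight hab
  have hW : ∀ {g : ℝ → CMat}, ContDiffOn ℝ ∞ g (Icc a b) →
      ContDiffOn ℝ ∞ (fun t => flagInertia α β (g t)) (Icc a b) :=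
    fun hg => (flagInertia α β).contDiff.comp_contDiffOn hg
  set B : ℝ → CMat := fun t => stripVelocity ε a b f (0, t) with hB
  set C : ℝ → CMat := fun t => stripField ε a b f (0, t) with hC
  set B' : ℝ → CMat := fun t => stripDerivRight ε a b (stripVelocity ε a b f) (0, t) with hB'
  set C' : ℝ → CMat := fun t => stripDerivRight ε a b (stripField ε a b f) (0, t) with hC'
  have cB : ContDiffOn ℝ ∞ B (Icc a b) := hBs.slice h0
  have cC : ContDiffOn ℝ ∞ C (Icc a b) := hCs.slice h0
  have cB' : ContDiffOn ℝ ∞ B' (Icc a b) := hB's.slice h0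
  have cC' : ContDiffOn ℝ ∞ C' (Icc a b) := hC's.slice h0
  have cE : ContDiffOn ℝ ∞ (fun t => reTrace (C t * eulerDefect α β (B t) (B' t))) (Icc a b) :=
    reTrace.contDiff.comp_contDiffOn
      (cC.mul ((hW cB').sub ((cB.mul (hW cB)).sub ((hW cB).mul cB))))
  have cH : ContDiffOn ℝ ∞
      (fun t => reTrace (flagInertia α β (B' t) * C t + flagInertia α β (B t) * C' t))
      (Icc a b) :=
    reTrace.contDiff.comp_contDiffOn (((hW cB').mul cC).add ((hW cB).mul cC'))
  have hint : ∀ {g : ℝ → ℝ}, ContDiffOn ℝ ∞ g (Icc a b) →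
      IntervalIntegrable g MeasureTheory.volume a b := fun hg =>
    ContinuousOn.intervalIntegrable (by rw [uIcc_of_le hab.le]; exact hg.continuousOn)
  -- Integration by parts, written as the fundamental theorem for Re tr(Λ(B) C).
  have hFTC := intervalIntegral.integral_eq_sub_of_hasDerivAt_of_le hab.le
    (f := fun t => reTrace (flagInertia α β (B t) * C t))
    (reTrace.contDiff.comp_contDiffOn ((hW cB).mul cC)).continuousOn
    (fun t ht => by
      have hn : Icc a b ∈ nhds t := Icc_mem_nhds ht.1 ht.2
      have ht' : t ∈ Icc a b := ⟨ht.1.le, ht.2.le⟩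
      have dB : HasDerivAt B (B' t) t := (hasDerivWithinAt_stripDerivRight hBs h0 ht').hasDerivAt hn
      have dC : HasDerivAt C (C' t) t := (hasDerivWithinAt_stripDerivRight hCs h0 ht').hasDerivAt hn
      have dL : HasDerivAt (fun t => flagInertia α β (B t)) (flagInertia α β (B' t)) t :=
        (flagInertia α β).hasFDerivAt.comp_hasDerivAt t dB
      exact reTrace.hasFDerivAt.comp_hasDerivAt t (dL.mul dC))
    (hint cH)
  refine (hasDerivAt_integral_strip hab hε (hBs.flagKinetic (α := α) (β := β))).congr_deriv ?_
  rw [← hFTC, ← intervalIntegral.integral_sub (hint cE) (hint cH)]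
  refine intervalIntegral.integral_congr fun t ht => ?_
  rw [uIcc_of_le hab.le] at ht
  have hp : ((0 : ℝ), t) ∈ strip ε a b := ⟨h0, ht⟩
  have hd : stripDerivLeft ε a b (fun p => flagKinetic α β (stripVelocity ε a b f p)) (0, t)
      = -reTrace (flagInertia α β (B t) * stripDerivLeft ε a b (stripVelocity ε a b f) (0, t)) :=
    (hasDerivAt_stripDerivLeft (hBs.flagKinetic (α := α) (β := β)) h0 ht).unique
      (hasDerivAt_stripDerivLeft hBs h0 ht).flagKinetic
  have hs : stripDerivLeft ε a b (stripVelocity ε a b f) (0, t)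
      = C' t + (C t * B t - B t * C t) := stripDerivLeft_stripVelocity hab hf hu hp
  simp only [hd, hs, eulerDefect, mul_add, mul_sub, map_add, map_sub]
  -- Cyclicity of the trace moves C to the front, so that [C, B] paired with Λ(B) becomes C paired
  -- with [B, Λ(B)].
  have t1 : reTrace (flagInertia α β (B t) * (C t * B t))
      = reTrace (C t * (B t * flagInertia α β (B t))) := by
    rw [reTrace_mul_comm, mul_assoc]
  have t2 : reTrace (flagInertia α β (B t) * (B t * C t))
      = reTrace (C t * (flagInertia α β (B t) * B t)) := by
    rw [← mul_assoc, reTrace_mul_comm]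
  rw [t1, t2, reTrace_mul_comm (flagInertia α β (B' t))]
  ring

end FirstVariation

/-! ### Frames as unitary matrices, phases as diagonal matrices. -/

section Frames

attribute [local instance] Matrix.linftyOpNormedRing Matrix.linftyOpNormedAlgebra
attribute [local instance] continuousStar_linftyOp

/-- The matrix whose rows are the vectors of a triple. -/
noncomputable def frameMatrix : (Fin 3 → EuclideanSpace ℂ (Fin 3)) ≃L[ℝ] CMat :=
  ContinuousLinearEquiv.piCongrRight fun _ => PiLp.continuousLinearEquiv 2 ℝ fun _ => ℂ

theorem frameMatrix_apply (u : Fin 3 → EuclideanSpace ℂ (Fin 3)) (i j : Fin 3) :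
    frameMatrix u i j = u i j := rfl

/-- The indices swap because the vectors are rows and the inner product is conjugate-linear in its
first argument. -/
theorem inner_eq_frameMatrix (u v : Fin 3 → EuclideanSpace ℂ (Fin 3)) (i j : Fin 3) :
    inner ℂ (u i) (v j) = (frameMatrix v * star (frameMatrix u)) j i := by
  simp [PiLp.inner_apply, Matrix.mul_apply, frameMatrix_apply, Matrix.star_apply]

theorem frameMatrix_mul_star (u : UnitaryFrame) :
    frameMatrix u.1 * star (frameMatrix u.1) = 1 := by
  ext i j
  rw [← inner_eq_frameMatrix, orthonormal_iff_ite.1 u.2, Matrix.one_apply]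
  simp only [eq_comm]

theorem star_mul_frameMatrix (u : UnitaryFrame) :
    star (frameMatrix u.1) * frameMatrix u.1 = 1 :=
  mul_eq_one_comm.1 (frameMatrix_mul_star u)

/-- The frame formed by the rows of a unitary matrix. -/
noncomputable def matrixFrame (U : CMat) (h : U * star U = 1) : UnitaryFrame :=
  ⟨frameMatrix.symm U, orthonormal_iff_ite.2 fun i j => by
    rw [inner_eq_frameMatrix, frameMatrix.apply_symm_apply, h, Matrix.one_apply]
    simp only [eq_comm]⟩

theorem frameMatrix_matrixFrame (U : CMat) (h : U * star U = 1) :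
    frameMatrix (matrixFrame U h).1 = U := frameMatrix.apply_symm_apply U

theorem frameMatrix_injective {u v : UnitaryFrame} (h : frameMatrix u.1 = frameMatrix v.1) :
    u = v := Subtype.ext (frameMatrix.injective h)

theorem Matrix.IsDiag.mul_cmat {X Y : CMat} (hX : X.IsDiag) (hY : Y.IsDiag) :
    (X * Y).IsDiag := by
  rw [← hX.diagonal_diag, ← hY.diagonal_diag, Matrix.diagonal_mul_diagonal]
  exact Matrix.isDiag_diagonal _

theorem Matrix.IsDiag.star_cmat {X : CMat} (hX : X.IsDiag) : (star X).IsDiag :=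
  hX.conjTranspose

theorem norm_diag_of_unitary {D : CMat} (hD : D.IsDiag) (h : D * star D = 1) (i : Fin 3) :
    D i i * conj (D i i) = 1 := by
  have h1 := congrFun (congrFun h i) i
  rw [← hD.diagonal_diag, Matrix.star_eq_conjTranspose, Matrix.diagonal_conjTranspose,
    Matrix.diagonal_mul_diagonal] at h1
  simpa using h1

/-- The off-diagonal entries of the transition matrix are inner products of distinct vectors, so
being diagonal means proportionality vector by vector; unitarity then makes the factors phases. -/
theorem toFlag_eq_iff (u v : UnitaryFrame) :
    u.toFlag = v.toFlag ↔ (frameMatrix v.1 * star (frameMatrix u.1)).IsDiag := by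
  constructor
  · intro h
    obtain ⟨φ, hφ⟩ := Quotient.exact h
    intro i j hij
    rw [← inner_eq_frameMatrix, hφ i, inner_smul_right, u.2.2 hij.symm, mul_zero]
  · intro h
    have hU : (frameMatrix v.1 * star (frameMatrix u.1)) *
        star (frameMatrix v.1 * star (frameMatrix u.1)) = 1 := by
      rw [star_mul, star_star, mul_assoc, ← mul_assoc (star _), star_mul_frameMatrix, one_mul,
        frameMatrix_mul_star]
    refine Quotient.sound ⟨fun i => ⟨(frameMatrix v.1 * star (frameMatrix u.1)) i i, ?_⟩, ?_⟩
    · have h1 := norm_diag_of_unitary h hU i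
      rw [Complex.mul_conj, Complex.normSq_eq_norm_sq] at h1
      refine mem_sphere_zero_iff_norm.2 ?_
      exact (pow_eq_one_iff_of_nonneg (norm_nonneg _) two_ne_zero).1 (by exact_mod_cast h1)
    · intro i
      have h2 : frameMatrix v.1 = (frameMatrix v.1 * star (frameMatrix u.1)) * frameMatrix u.1 := by
        rw [mul_assoc, star_mul_frameMatrix, mul_one]
      ext k
      have h3 := congrFun (congrFun h2 i) k
      rw [← h.diagonal_diag, Matrix.diagonal_mul] at h3
      exact h3

theorem isDiag_of_hasDerivWithinAt {D : ℝ → CMat} {D' : CMat} {S : Set ℝ} {t : ℝ}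
    (hS : UniqueDiffWithinAt ℝ S t) (ht : t ∈ S) (hD : ∀ τ ∈ S, (D τ).IsDiag)
    (h : HasDerivWithinAt D D' S t) : D'.IsDiag := by
  intro i j hij
  let e : CMat →L[ℝ] ℂ := LinearMap.toContinuousLinearMap
    { toFun := fun X => X i j
      map_add' := fun _ _ => rfl
      map_smul' := fun _ _ => rfl }
  have h1 : HasDerivWithinAt (fun τ => e (D τ)) (e D') S t :=
    e.hasFDerivAt.comp_hasDerivWithinAt t h
  have h2 : HasDerivWithinAt (fun τ => e (D τ)) 0 S t :=
    (hasDerivWithinAt_const t S (0 : ℂ)).congr (fun τ hτ => hD τ hτ hij) (hD t ht hij)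
  exact hS.eq_deriv _ h1 h2

/-- Momentum has no diagonal part. This removes the boundary terms of the first variation and makes
vertical motion cost no energy. -/
theorem reTrace_flagInertia_mul_isDiag (α β : ℝ) (X : CMat) {K : CMat} (hK : K.IsDiag) :
    reTrace (flagInertia α β X * K) = 0 := by
  rw [reTrace_apply, ← hK.diagonal_diag, Matrix.trace_fin_three]
  simp [Matrix.mul_diagonal, flagInertia_apply]

/-- Inertia acts entry by entry, so it commutes with conjugation by a diagonal matrix, and it
ignores the diagonal term `K`; the trace is conjugation invariant. -/
theorem flagKinetic_gauge (α β : ℝ) (X : CMat) {D K : CMat} (hD : D.IsDiag) (hK : K.IsDiag)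
    (hu : D * star D = 1) :
    flagKinetic α β (D * X * star D + K) = flagKinetic α β X := by
  have hu' : star D * D = 1 := mul_eq_one_comm.1 hu
  have h1 : flagInertia α β (D * X * star D + K) = D * flagInertia α β X * star D := by
    rw [← hD.diagonal_diag, Matrix.star_eq_conjTranspose, Matrix.diagonal_conjTranspose]
    have hK' : ∀ i j, i ≠ j → K i j = 0 := fun i j hij => hK hij
    ext i j
    rw [Matrix.mul_diagonal, Matrix.diagonal_mul]
    fin_cases i <;> fin_cases j <;>
      simp [flagInertia_apply, Matrix.mul_diagonal, Matrix.diagonal_mul, hK'] <;> ring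
  have h2 : reTrace (D * flagInertia α β X * star D * K) = 0 := by
    rw [← h1, reTrace_flagInertia_mul_isDiag α β _ hK]
  have h3 : reTrace (D * flagInertia α β X * star D * (D * X * star D))
      = reTrace (flagInertia α β X * X) := by
    have : D * flagInertia α β X * star D * (D * X * star D)
        = D * (flagInertia α β X * X * star D) := by
      simp only [mul_assoc]
      rw [← mul_assoc (star D) D, hu', one_mul]
    rw [this, reTrace_mul_comm, mul_assoc, hu', mul_one]
  rw [flagKinetic, flagKinetic, h1, mul_add, map_add, h2, h3, add_zero]

/-- For a skew-Hermitian X the product of the entries `(i, j)` and `(j, i)` is -|Xᵢⱼ|², and the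
trace counts each pair twice; this accounts for the factor -1/2. -/
theorem flagMetric_eq_flagKinetic (α β : ℝ) (u v : Fin 3 → EuclideanSpace ℂ (Fin 3))
    (h : star (frameMatrix v * star (frameMatrix u)) = -(frameMatrix v * star (frameMatrix u))) :
    flagMetric α β β u v = flagKinetic α β (frameMatrix v * star (frameMatrix u)) := by
  rw [flagMetric, inner_eq_frameMatrix, inner_eq_frameMatrix, inner_eq_frameMatrix]
  set X := frameMatrix v * star (frameMatrix u)
  have hX : ∀ i j, X i j = -conj (X j i) := fun i j => by
    have := congrFun (congrFun h j) i
    rw [Matrix.star_apply, Matrix.neg_apply] at this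
    have h2 := congrArg conj this
    simpa using h2
  have hn : ∀ i j, (X i j * X j i).re = -‖X i j‖ ^ 2 := fun i j => by
    rw [hX j i, mul_neg, Complex.mul_conj, Complex.normSq_eq_norm_sq, Complex.neg_re,
      Complex.ofReal_re]
  have hn' : ∀ i j, (X j i * X i j).re = -‖X i j‖ ^ 2 := fun i j => by rw [mul_comm, hn]
  have key : reTrace (flagInertia α β X * X)
      = -2 * (1 / α * ‖X 1 0‖ ^ 2 + 1 / β * ‖X 2 1‖ ^ 2 + 1 / β * ‖X 2 0‖ ^ 2) := by
    rw [reTrace_apply, Matrix.trace_fin_three]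
    simp only [Matrix.mul_apply, Fin.sum_univ_three, flagInertia_apply, Matrix.of_apply,
      Matrix.cons_val', Matrix.cons_val_zero, Matrix.cons_val_one, Matrix.cons_val,
      zero_mul, zero_add, add_zero, mul_assoc, Complex.add_re]
    have hr : ∀ (c : ℝ) (z : ℂ), (1 / (c : ℂ) * z).re = 1 / c * z.re := fun c z => by
      rw [← Complex.ofReal_one, ← Complex.ofReal_div, Complex.re_ofReal_mul]
    simp only [hr, hn 1 0, hn' 1 0, hn 2 0, hn' 2 0, hn 2 1, hn' 2 1]
    ring
  rw [flagKinetic, key]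
  ring

theorem frameMatrix_derivWithin (w : ℝ → Fin 3 → EuclideanSpace ℂ (Fin 3)) {S : Set ℝ} {t : ℝ}
    (hS : UniqueDiffWithinAt ℝ S t) :
    frameMatrix (derivWithin w S t) = derivWithin (fun τ => frameMatrix (w τ)) S t := by
  have h := frameMatrix.comp_fderivWithin (f := w) hS
  have h2 := congrArg (fun T => T 1) h
  exact h2.symm

end Frames

/-! ### Velocities of frame curves; the Euler-Lagrange equation suffices. -/

section Geodesics

attribute [local instance] Matrix.linftyOpNormedRing Matrix.linftyOpNormedAlgebra
attribute [local instance] continuousStar_linftyOp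

/-- The matrix `u̇ u*` of velocity components of a curve of frames. -/
noncomputable def frameOmega (u : ℝ → UnitaryFrame) (t : ℝ) : CMat :=
  deriv (fun τ => frameMatrix (u τ).1) t * star (frameMatrix (u t).1)

theorem contDiffOn_frameMatrix {E : Type*} [NormedAddCommGroup E] [NormedSpace ℝ E]
    {w : E → Fin 3 → EuclideanSpace ℂ (Fin 3)} {S : Set E} :
    ContDiffOn ℝ ∞ (fun p => frameMatrix (w p)) S ↔ ContDiffOn ℝ ∞ w S :=
  frameMatrix.comp_contDiffOn_iff

theorem hasDerivAt_frameMatrix {u : ℝ → UnitaryFrame} {I : Set ℝ} (hI : IsOpen I)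
    (hu : ContDiffOn ℝ ∞ (fun t => (u t).1) I) {t : ℝ} (ht : t ∈ I) :
    HasDerivAt (fun τ => frameMatrix (u τ).1) (frameOmega u t * frameMatrix (u t).1) t := by
  have h := (((contDiffOn_frameMatrix.2 hu).contDiffAt (hI.mem_nhds ht)).differentiableAt
    (by simp)).hasDerivAt
  have h2 : frameOmega u t * frameMatrix (u t).1 = deriv (fun τ => frameMatrix (u τ).1) t := by
    rw [frameOmega, mul_assoc, star_mul_frameMatrix, mul_one]
  exact h.congr_deriv h2.symm

theorem contDiffOn_frameOmega {u : ℝ → UnitaryFrame} {I : Set ℝ} (hI : IsOpen I)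
    (hu : ContDiffOn ℝ ∞ (fun t => (u t).1) I) : ContDiffOn ℝ ∞ (frameOmega u) I :=
  ((contDiffOn_frameMatrix.2 hu).deriv_of_isOpen hI (m := ∞) (by simp)).mul
    (contDiffOn_frameMatrix.2 hu).matrix_star

theorem hasDerivAt_frameOmega {u : ℝ → UnitaryFrame} {I : Set ℝ} (hI : IsOpen I)
    (hu : ContDiffOn ℝ ∞ (fun t => (u t).1) I) {t : ℝ} (ht : t ∈ I) :
    HasDerivAt (frameOmega u) (deriv (frameOmega u) t) t :=
  (((contDiffOn_frameOmega hI hu).contDiffAt (hI.mem_nhds ht)).differentiableAt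
    (by simp)).hasDerivAt

theorem star_frameOmega {u : ℝ → UnitaryFrame} {I : Set ℝ} (hI : IsOpen I)
    (hu : ContDiffOn ℝ ∞ (fun t => (u t).1) I) {t : ℝ} (ht : t ∈ I) :
    star (frameOmega u t) = -frameOmega u t := by
  have h := (((contDiffOn_frameMatrix.2 hu).contDiffAt (hI.mem_nhds ht)).differentiableAt
    (by simp)).hasDerivAt
  refine mul_star_skew ((h.mul h.star).unique ?_)
  refine (hasDerivAt_const t (1 : CMat)).congr_of_eventuallyEq ?_
  exact Filter.Eventually.of_forall fun τ => frameMatrix_mul_star (u τ)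

variable {ε a b : ℝ}

theorem flagAction_eq (α β : ℝ) (hab : a < b) {V : ℝ → ℝ → UnitaryFrame}
    (hV : ContDiffOn ℝ ∞ (fun p : ℝ × ℝ => (V p.1 p.2).1) (strip ε a b)) {s : ℝ}
    (hs : s ∈ Ioo (-ε) ε) :
    flagAction α β β a b (V s) = ∫ t in a..b, flagKinetic α β
      (stripVelocity ε a b (fun p => frameMatrix (V p.1 p.2).1) (s, t)) := by
  have hf := contDiffOn_frameMatrix.2 hV
  refine intervalIntegral.integral_congr fun t ht => ?_
  rw [uIcc_of_le hab.le] at ht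
  have hd : frameMatrix (derivWithin (fun τ => (V s τ).1) (Icc a b) t)
      = stripDerivRight ε a b (fun p => frameMatrix (V p.1 p.2).1) (s, t) := by
    rw [frameMatrix_derivWithin _ (uniqueDiffOn_Icc hab t ht)]
    exact (hasDerivWithinAt_stripDerivRight hf hs ht).derivWithin (uniqueDiffOn_Icc hab t ht)
  have hskew := stripVelocity_skew hab hf (fun p _ => frameMatrix_mul_star _)
    (p := (s, t)) ⟨hs, ht⟩
  have hv : stripVelocity ε a b (fun p => frameMatrix (V p.1 p.2).1) (s, t)
      = frameMatrix (derivWithin (fun τ => (V s τ).1) (Icc a b) t)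
        * star (frameMatrix (V s t).1) := by rw [hd]; rfl
  rw [hv] at hskew ⊢
  exact flagMetric_eq_flagKinetic α β _ _ hskew

theorem stripVelocity_eq_frameOmega {u : ℝ → UnitaryFrame} {I : Set ℝ} (hI : IsOpen I)
    (hu : ContDiffOn ℝ ∞ (fun t => (u t).1) I) (hab : a < b) (hε : 0 < ε) (hsub : Icc a b ⊆ I)
    {f : ℝ × ℝ → CMat} (hf : ContDiffOn ℝ ∞ f (strip ε a b))
    (h0 : ∀ t ∈ Icc a b, f (0, t) = frameMatrix (u t).1) {t : ℝ} (ht : t ∈ Icc a b) :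
    stripVelocity ε a b f (0, t) = frameOmega u t := by
  have hε0 : (0 : ℝ) ∈ Ioo (-ε) ε := ⟨by linarith, hε⟩
  have hd : stripDerivRight ε a b f (0, t) = frameOmega u t * frameMatrix (u t).1 :=
    (uniqueDiffOn_Icc hab t ht).eq_deriv _ (hasDerivWithinAt_stripDerivRight hf hε0 ht)
      ((hasDerivAt_frameMatrix hI hu (hsub ht)).hasDerivWithinAt.congr h0 (h0 t ht))
  rw [stripVelocity, hd, h0 t ht, mul_assoc, frameMatrix_mul_star, mul_one]

theorem stripDerivRight_stripVelocity_eq {u : ℝ → UnitaryFrame} {I : Set ℝ} (hI : IsOpen I)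
    (hu : ContDiffOn ℝ ∞ (fun t => (u t).1) I) (hab : a < b) (hε : 0 < ε) (hsub : Icc a b ⊆ I)
    {f : ℝ × ℝ → CMat} (hf : ContDiffOn ℝ ∞ f (strip ε a b))
    (h0 : ∀ t ∈ Icc a b, f (0, t) = frameMatrix (u t).1) {t : ℝ} (ht : t ∈ Icc a b) :
    stripDerivRight ε a b (stripVelocity ε a b f) (0, t) = deriv (frameOmega u) t := by
  have hε0 : (0 : ℝ) ∈ Ioo (-ε) ε := ⟨by linarith, hε⟩
  have h1 := fun τ hτ => stripVelocity_eq_frameOmega hI hu hab hε hsub hf h0 (t := τ) hτ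
  exact (uniqueDiffOn_Icc hab t ht).eq_deriv _
    (hasDerivWithinAt_stripDerivRight (hf.stripVelocity hab) hε0 ht)
    ((hasDerivAt_frameOmega hI hu (hsub ht)).hasDerivWithinAt.congr h1 (h1 t ht))

/-- The first variation of the action at a curve represented by smooth frames. -/
theorem hasDerivAt_flagKinetic_frames (α β : ℝ) {u : ℝ → UnitaryFrame} {I : Set ℝ} (hI : IsOpen I)
    (hu : ContDiffOn ℝ ∞ (fun t => (u t).1) I) (hab : a < b) (hε : 0 < ε) (hsub : Icc a b ⊆ I)
    {f : ℝ × ℝ → CMat} (hf : ContDiffOn ℝ ∞ f (strip ε a b))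
    (hfu : ∀ p ∈ strip ε a b, f p * star (f p) = 1)
    (h0 : ∀ t ∈ Icc a b, f (0, t) = frameMatrix (u t).1)
    (ha : (stripField ε a b f (0, a)).IsDiag) (hb : (stripField ε a b f (0, b)).IsDiag) :
    HasDerivAt (fun s => ∫ t in a..b, flagKinetic α β (stripVelocity ε a b f (s, t)))
      (∫ t in a..b, reTrace (stripField ε a b f (0, t) *
          eulerDefect α β (frameOmega u t) (deriv (frameOmega u) t))) 0 := by
  refine (hasDerivAt_integral_flagKinetic α β hab hε hf hfu).congr_deriv ?_
  rw [reTrace_flagInertia_mul_isDiag α β _ ha, reTrace_flagInertia_mul_isDiag α β _ hb, sub_zero,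
    sub_zero]
  refine intervalIntegral.integral_congr fun t ht => ?_
  rw [uIcc_of_le hab.le] at ht
  rw [stripVelocity_eq_frameOmega hI hu hab hε hsub hf h0 ht,
    stripDerivRight_stripVelocity_eq hI hu hab hε hsub hf h0 ht]

theorem stripField_isDiag (hε : 0 < ε) {f : ℝ × ℝ → CMat} (hf : ContDiffOn ℝ ∞ f (strip ε a b))
    {t : ℝ} (ht : t ∈ Icc a b)
    (hd : ∀ s ∈ Ioo (-ε) ε, (f (s, t) * star (f (0, t))).IsDiag) :
    (stripField ε a b f (0, t)).IsDiag := by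
  have hε0 : (0 : ℝ) ∈ Ioo (-ε) ε := ⟨by linarith, hε⟩
  exact isDiag_of_hasDerivWithinAt (isOpen_Ioo.uniqueDiffWithinAt hε0) hε0 hd
    ((hasDerivAt_stripDerivLeft hf hε0 ht).mul_const (star (f (0, t)))).hasDerivWithinAt

theorem isDiag_mul_star_of_toFlag_eq {u v : UnitaryFrame} (h : u.toFlag = v.toFlag) :
    (frameMatrix v.1 * star (frameMatrix u.1)).IsDiag := (toFlag_eq_iff u v).1 h

/-- A curve represented by smooth frames that satisfy the Euler-Lagrange equation is a geodesic. -/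
theorem isFlagGeodesicOn_of_eulerDefect {α β : ℝ} {u : ℝ → UnitaryFrame} {c : ℝ → FlagManifold}
    {I : Set ℝ} (hI : IsOpen I) (hu : ContDiffOn ℝ ∞ (fun t => (u t).1) I)
    (hc : ∀ t ∈ I, (u t).toFlag = c t)
    (hE : ∀ t ∈ I, eulerDefect α β (frameOmega u t) (deriv (frameOmega u) t) = 0) :
    IsFlagGeodesicOn α β β c I := by
  refine ⟨fun t₀ _ => ⟨univ, isOpen_univ, mem_univ _, u, by simpa using hu, by simpa using hc⟩, ?_⟩
  intro a b hab hsub ε hε V hV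
  have hε0 : (0 : ℝ) ∈ Ioo (-ε) ε := ⟨by linarith, hε⟩
  set f : ℝ × ℝ → CMat := fun p => frameMatrix (V p.1 p.2).1 with hfdef
  have hf : ContDiffOn ℝ ∞ f (strip ε a b) := contDiffOn_frameMatrix.2 hV.smooth
  have hfu : ∀ p, f p * star (f p) = 1 := fun p => frameMatrix_mul_star _
  have hfu' : ∀ p, star (f p) * f p = 1 := fun p => star_mul_frameMatrix _
  -- At s = 0 the variation represents `c` only up to phases relative to `u`. Multiplying by this
  -- diagonal correction, which depends on t alone, makes the base curve equal to `u`.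
  set D : ℝ × ℝ → CMat := fun p => frameMatrix (u p.2).1 * star (f (0, p.2)) with hDdef
  have hU : ContDiffOn ℝ ∞ (fun p : ℝ × ℝ => frameMatrix (u p.2).1) (strip ε a b) :=
    (contDiffOn_frameMatrix.2 hu).comp contDiff_snd.contDiffOn fun p hp => hsub hp.2
  have hf0 : ContDiffOn ℝ ∞ (fun p : ℝ × ℝ => f (0, p.2)) (strip ε a b) :=
    hf.comp (contDiff_const.prodMk contDiff_snd).contDiffOn fun p hp => ⟨hε0, hp.2⟩
  have hD : ContDiffOn ℝ ∞ D (strip ε a b) := hU.mul hf0.matrix_star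
  have hDu : ∀ p, D p * star (D p) = 1 := fun p => by
    simp only [hDdef, star_mul, star_star]
    rw [mul_assoc, ← mul_assoc (star _), hfu', one_mul, frameMatrix_mul_star]
  have hDd : ∀ p ∈ strip ε a b, (D p).IsDiag := fun p hp =>
    isDiag_mul_star_of_toFlag_eq ((hV.base p.2 hp.2).trans (hc p.2 (hsub hp.2)).symm)
  have hg : ContDiffOn ℝ ∞ (fun p => D p * f p) (strip ε a b) := hD.mul hf
  have hgu : ∀ p ∈ strip ε a b, D p * f p * star (D p * f p) = 1 := fun p _ => by
    rw [star_mul, mul_assoc, ← mul_assoc (f p), hfu, one_mul, hDu]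
  have hg0 : ∀ t ∈ Icc a b, D (0, t) * f (0, t) = frameMatrix (u t).1 := fun t _ => by
    simp only [hDdef]
    rw [mul_assoc, hfu', mul_one]
  -- At the endpoints only the flag is fixed, so the field there is diagonal, not necessarily zero.
  have hend : ∀ t ∈ Icc a b, (∀ s ∈ Ioo (-ε) ε, (V s t).toFlag = c t) →
      (stripField ε a b (fun p => D p * f p) (0, t)).IsDiag := by
    intro t ht h
    refine stripField_isDiag hε hg ht fun s hs => ?_
    rw [hg0 t ht]
    have h1 : (f (s, t) * star (frameMatrix (u t).1)).IsDiag :=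
      isDiag_mul_star_of_toFlag_eq ((hc t (hsub ht)).trans (h s hs).symm)
    rw [mul_assoc]
    exact (hDd (s, t) ⟨hs, ht⟩).mul_cmat h1
  have hmain := hasDerivAt_flagKinetic_frames α β hI hu hab hε hsub hg hgu hg0
    (hend a (left_mem_Icc.2 hab.le) hV.left) (hend b (right_mem_Icc.2 hab.le) hV.right)
  have hzero : (∫ t in a..b, reTrace (stripField ε a b (fun p => D p * f p) (0, t) *
      eulerDefect α β (frameOmega u t) (deriv (frameOmega u) t))) = 0 := by
    rw [← intervalIntegral.integral_zero (a := a) (b := b) (μ := MeasureTheory.volume)]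
    refine intervalIntegral.integral_congr fun t ht => ?_
    rw [uIcc_of_le hab.le] at ht
    rw [hE t (hsub ht), mul_zero, map_zero]
  rw [hzero] at hmain
  refine hmain.congr_of_eventuallyEq ?_
  filter_upwards [isOpen_Ioo.mem_nhds hε0] with s hs
  rw [flagAction_eq α β hab hV.smooth hs]
  refine intervalIntegral.integral_congr fun t ht => ?_
  rw [uIcc_of_le hab.le] at ht
  have hp : (s, t) ∈ strip ε a b := ⟨hs, ht⟩
  have hd : stripDerivRight ε a b (fun p => D p * f p) (s, t)
      = stripDerivRight ε a b D (s, t) * f (s, t) + D (s, t) * stripDerivRight ε a b f (s, t) :=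
    (uniqueDiffOn_Icc hab t ht).eq_deriv _ (hasDerivWithinAt_stripDerivRight hg hs ht)
      ((hasDerivWithinAt_stripDerivRight hD hs ht).mul (hasDerivWithinAt_stripDerivRight hf hs ht))
  -- The correction conjugates the velocity by D and adds the diagonal term ∂ₜD D*, a gauge change
  -- that leaves the action unaltered.
  have hv : stripVelocity ε a b (fun p => D p * f p) (s, t)
      = D (s, t) * stripVelocity ε a b f (s, t) * star (D (s, t))
        + stripDerivRight ε a b D (s, t) * star (D (s, t)) := by
    rw [stripVelocity, hd, stripVelocity, star_mul, add_mul, add_comm]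
    congr 1
    · simp only [mul_assoc]
    · rw [mul_assoc, ← mul_assoc (f (s, t)), hfu, one_mul]
  have hD'd : (stripDerivRight ε a b D (s, t)).IsDiag :=
    isDiag_of_hasDerivWithinAt (uniqueDiffOn_Icc hab t ht) ht (fun τ hτ => hDd (s, τ) ⟨hs, hτ⟩)
      (hasDerivWithinAt_stripDerivRight hD hs ht)
  rw [hv, flagKinetic_gauge α β _ (hDd _ hp) (hD'd.mul_cmat (hDd _ hp).star_cmat) (hDu _)]

end Geodesics

/-! ### Necessity of the Euler-Lagrange equation. -/

section EulerLagrange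

attribute [local instance] Matrix.linftyOpNormedRing Matrix.linftyOpNormedAlgebra
attribute [local instance] continuousStar_linftyOp

theorem exp_smul_mul_star {X : CMat} (hX : star X = -X) (r : ℝ) :
    NormedSpace.exp (r • X) * star (NormedSpace.exp (r • X)) = 1 := by
  refine (Unitary.mem_iff.1 (NormedSpace.exp_mem_unitary_of_mem_skewAdjoint ?_)).2
  rw [skewAdjoint.mem_iff, star_smul, hX, smul_neg]
  rfl

theorem contDiff_exp_smul (X : CMat) : ContDiff ℝ ∞ (fun r : ℝ => NormedSpace.exp (r • X)) :=
  (contDiff_iff_contDiffAt.2 fun Y : CMat => (NormedSpace.exp_analytic (𝕂 := ℝ) Y).contDiffAt).comp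
    (contDiff_id.smul contDiff_const)

theorem star_flagInertia (α β : ℝ) (X : CMat) :
    star (flagInertia α β X) = flagInertia α β (star X) := by
  ext i j
  fin_cases i <;> fin_cases j <;> simp [flagInertia_apply, Matrix.star_apply]

theorem star_eulerDefect {α β : ℝ} {B B' : CMat} (hB : star B = -B) (hB' : star B' = -B') :
    star (eulerDefect α β B B') = -eulerDefect α β B B' := by
  have h1 : star (flagInertia α β B) = -flagInertia α β B := by
    rw [star_flagInertia, hB, map_neg]
  have h2 : star (flagInertia α β B') = -flagInertia α β B' := by
    rw [star_flagInertia, hB', map_neg]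
  rw [eulerDefect, star_sub, star_sub, star_mul, star_mul, hB, h1, h2]
  noncomm_ring

theorem hasDerivAt_exp_mul_smul (X : CMat) (r : ℝ) :
    HasDerivAt (fun s : ℝ => NormedSpace.exp ((s * r) • X)) (r • X) 0 := by
  have h := hasDerivAt_exp_smul_const (r • X) (0 : ℝ)
  rw [zero_smul, NormedSpace.exp_zero, one_mul] at h
  have e : (fun s : ℝ => NormedSpace.exp ((s * r) • X))
      = fun s : ℝ => NormedSpace.exp (s • r • X) :=
    funext fun s => by rw [mul_smul]
  rw [e]
  exact h

/-- Variations along a constant generator, with a time profile `η`. -/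
theorem integral_reTrace_mul_eulerDefect {α β : ℝ} {u : ℝ → UnitaryFrame}
    {c : ℝ → FlagManifold} {I : Set ℝ} (hI : IsOpen I)
    (hu : ContDiffOn ℝ ∞ (fun t => (u t).1) I) (hc : ∀ t ∈ I, (u t).toFlag = c t)
    (hg : IsFlagGeodesicOn α β β c I) {a b : ℝ} (hab : a < b) (hsub : Icc a b ⊆ I) {X : CMat}
    (hX : star X = -X) {η : ℝ → ℝ} (hη : ContDiff ℝ ∞ η) (ha : η a = 0) (hb : η b = 0) :
    ∫ t in a..b, η t * reTrace (X * eulerDefect α β (frameOmega u t) (deriv (frameOmega u) t))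
      = 0 := by
  -- Rotating by exp(s η(t) X) stays unitary, fixes the frames where η vanishes, and has field η X
  -- at s = 0. It exists for all s, so the width 1 is arbitrary.
  set f : ℝ × ℝ → CMat := fun p =>
    NormedSpace.exp ((p.1 * η p.2) • X) * frameMatrix (u p.2).1 with hfdef
  have hfu : ∀ p, f p * star (f p) = 1 := fun p => by
    simp only [hfdef, star_mul]
    rw [mul_assoc, ← mul_assoc (frameMatrix _), frameMatrix_mul_star, one_mul,
      exp_smul_mul_star hX]
  have hU : ContDiffOn ℝ ∞ (fun p : ℝ × ℝ => frameMatrix (u p.2).1) (strip 1 a b) :=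
    (contDiffOn_frameMatrix.2 hu).comp contDiff_snd.contDiffOn fun p hp => hsub hp.2
  have hf : ContDiffOn ℝ ∞ f (strip 1 a b) :=
    ((contDiff_exp_smul X).comp (contDiff_fst.mul (hη.comp contDiff_snd))).contDiffOn.mul hU
  have hf1 : ∀ s t, s * η t = 0 → f (s, t) = frameMatrix (u t).1 := fun s t h => by
    simp only [hfdef]
    rw [h, zero_smul, NormedSpace.exp_zero, one_mul]
  set V : ℝ → ℝ → UnitaryFrame := fun s t => matrixFrame (f (s, t)) (hfu _) with hVdef
  have hVf : ∀ p : ℝ × ℝ, frameMatrix (V p.1 p.2).1 = f p := fun p =>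
    frameMatrix_matrixFrame _ _
  have hVu : ∀ s t, s * η t = 0 → V s t = u t := fun s t h =>
    frameMatrix_injective ((hVf (s, t)).trans (hf1 s t h))
  have hVs : ContDiffOn ℝ ∞ (fun p : ℝ × ℝ => (V p.1 p.2).1) (strip 1 a b) := by
    rw [← contDiffOn_frameMatrix]
    exact hf.congr fun p _ => hVf p
  have hbase : ∀ t ∈ Icc a b, ∀ s, s * η t = 0 → (V s t).toFlag = c t := fun t ht s h => by
    rw [hVu s t h, hc t (hsub ht)]
  have hV : IsFlagVariation c a b 1 V :=
    ⟨hVs, fun t ht => hbase t ht 0 (zero_mul _),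
      fun s _ => hbase a (left_mem_Icc.2 hab.le) s (by rw [ha, mul_zero]),
      fun s _ => hbase b (right_mem_Icc.2 hab.le) s (by rw [hb, mul_zero])⟩
  have h0 : (0 : ℝ) ∈ Ioo (-1 : ℝ) 1 := by norm_num
  have hfield : ∀ t ∈ Icc a b, stripField 1 a b f (0, t) = η t • X := by
    intro t ht
    have e1 : HasDerivAt (fun s => f (s, t)) (η t • X * frameMatrix (u t).1) 0 :=
      (hasDerivAt_exp_mul_smul X (η t)).mul_const (frameMatrix (u t).1)
    have e4 : stripDerivLeft 1 a b f (0, t) = η t • X * frameMatrix (u t).1 :=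
      (hasDerivAt_stripDerivLeft hf h0 ht).unique e1
    rw [stripField, e4, hf1 0 t (zero_mul _), mul_assoc, frameMatrix_mul_star, mul_one]
  have hdiag : ∀ t ∈ Icc a b, η t = 0 → (stripField 1 a b f (0, t)).IsDiag := fun t ht h => by
    rw [hfield t ht, h, zero_smul]
    exact Matrix.isDiag_zero
  have hmain := hasDerivAt_flagKinetic_frames α β hI hu hab one_pos hsub hf (fun p _ => hfu p)
    (fun t _ => hf1 0 t (zero_mul _)) (hdiag a (left_mem_Icc.2 hab.le) ha)
    (hdiag b (right_mem_Icc.2 hab.le) hb)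
  have hact : HasDerivAt
      (fun s => ∫ t in a..b, flagKinetic α β (stripVelocity 1 a b f (s, t))) 0 0 := by
    refine (hg.2 a b hab hsub 1 one_pos V hV).congr_of_eventuallyEq ?_
    filter_upwards [isOpen_Ioo.mem_nhds h0] with s hs
    rw [flagAction_eq α β hab hVs hs]
    simp only [hVf]
  rw [← hmain.unique hact]
  refine intervalIntegral.integral_congr fun t ht => ?_
  rw [uIcc_of_le hab.le] at ht
  simp only [hfield t ht, smul_mul_assoc]
  exact (reTrace.map_smul (η t) _).symm

/-- Geodesics satisfy the Euler-Lagrange equation. -/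
theorem IsFlagGeodesicOn.eulerDefect_eq_zero {α β : ℝ} {u : ℝ → UnitaryFrame}
    {c : ℝ → FlagManifold} {I : Set ℝ} (hg : IsFlagGeodesicOn α β β c I) (hI : IsOpen I)
    (hu : ContDiffOn ℝ ∞ (fun t => (u t).1) I) (hc : ∀ t ∈ I, (u t).toFlag = c t)
    {t₀ : ℝ} (ht₀ : t₀ ∈ I) :
    eulerDefect α β (frameOmega u t₀) (deriv (frameOmega u) t₀) = 0 := by
  obtain ⟨δ, hδ, hball⟩ := Metric.nhds_basis_closedBall.mem_iff.1 (hI.mem_nhds ht₀)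
  rw [Real.closedBall_eq_Icc] at hball
  set a := t₀ - δ with hadef
  set b := t₀ + δ with hbdef
  have hab : a < b := by linarith
  have ht : t₀ ∈ Ioo a b := ⟨by linarith, by linarith⟩
  have hΩ := contDiffOn_frameOmega hI hu
  have hΩ' : ContDiffOn ℝ ∞ (deriv (frameOmega u)) I := hΩ.deriv_of_isOpen hI (by simp)
  have hW : ∀ {g : ℝ → CMat}, ContDiffOn ℝ ∞ g I →
      ContDiffOn ℝ ∞ (fun t => flagInertia α β (g t)) I :=
    fun hg => (flagInertia α β).contDiff.comp_contDiffOn hg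
  set E : ℝ → CMat := fun t => eulerDefect α β (frameOmega u t) (deriv (frameOmega u) t) with hE
  have hEc : ContDiffOn ℝ ∞ E I := (hW hΩ').sub ((hΩ.mul (hW hΩ)).sub ((hW hΩ).mul hΩ))
  have hΩ's : star (deriv (frameOmega u) t₀) = -deriv (frameOmega u) t₀ := by
    have h1 := (hasDerivAt_frameOmega hI hu ht₀).star
    have h2 := (hasDerivAt_frameOmega hI hu ht₀).neg
    refine h1.unique (h2.congr_of_eventuallyEq ?_)
    filter_upwards [hI.mem_nhds ht₀] with t ht
    exact star_frameOmega hI hu ht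
  -- The value of the defect at t₀ is itself an admissible constant direction X; testing with it
  -- gives a squared norm.
  have hskew : star (E t₀) = -E t₀ := star_eulerDefect (star_frameOmega hI hu ht₀) hΩ's
  have hφc : ContinuousOn (fun t => reTrace (E t₀ * E t)) (Ioo a b) :=
    ((reTrace.contDiff.comp_contDiffOn (contDiffOn_const.mul hEc)).continuousOn).mono
      (Ioo_subset_Icc_self.trans hball)
  -- The fundamental lemma gives vanishing almost everywhere; continuity then upgrades it to every
  -- point, in particular t₀.
  have hae := isOpen_Ioo.ae_eq_zero_of_integral_contDiff_smul_eq_zero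
    (μ := MeasureTheory.volume) (hφc.locallyIntegrableOn measurableSet_Ioo) (by
      intro η hη _ hsupp
      have hout : ∀ t, t ∉ Ioo a b → η t = 0 := fun t ht => by
        by_contra h
        exact ht (hsupp (subset_tsupport _ h))
      have h := integral_reTrace_mul_eulerDefect hI hu hc hg hab hball hskew hη
        (hout a left_notMem_Ioo) (hout b right_notMem_Ioo)
      rw [intervalIntegral.integral_of_le hab.le,
        MeasureTheory.setIntegral_eq_integral_of_forall_compl_eq_zero] at h
      · exact h
      · intro t ht
        rw [hout t fun h => ht (Ioo_subset_Ioc_self h), zero_mul])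
  have hzero : EqOn (fun t => reTrace (E t₀ * E t)) (fun _ => 0) (Ioo a b) :=
    MeasureTheory.Measure.eqOn_open_of_ae_eq (μ := MeasureTheory.volume)
      ((MeasureTheory.ae_restrict_iff' measurableSet_Ioo).2 hae) isOpen_Ioo hφc continuousOn_const
  have h1 : reTrace (E t₀ * E t₀) = 0 := hzero ht
  have h2 : (star (E t₀) * E t₀).trace.re = 0 := by
    rw [hskew, neg_mul, Matrix.trace_neg, Complex.neg_re, ← reTrace_apply, h1, neg_zero]
  have h3 : (star (E t₀) * E t₀).trace.re = ∑ j, ∑ i, ‖E t₀ i j‖ ^ 2 := by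
    simp [Matrix.trace, Matrix.mul_apply, Matrix.star_apply, ← Complex.normSq_eq_norm_sq,
      Complex.normSq_apply]
  rw [h3] at h2
  ext i j
  have h4 := (Finset.sum_eq_zero_iff_of_nonneg fun j _ =>
    Finset.sum_nonneg fun i _ => sq_nonneg _).1 h2 j (Finset.mem_univ _)
  have h5 := (Finset.sum_eq_zero_iff_of_nonneg fun i _ => sq_nonneg _).1 h4 i (Finset.mem_univ _)
  exact norm_eq_zero.1 (pow_eq_zero_iff two_ne_zero |>.1 h5)

end EulerLagrange

/-! ### The explicit curve and its velocity. -/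

section Formula

attribute [local instance] Matrix.linftyOpNormedRing Matrix.linftyOpNormedAlgebra
attribute [local instance] continuousStar_linftyOp

/-- The part of the velocity that mixes the first two vectors. -/
noncomputable def blockPart (a₂₁ : ℂ) : CMat := !![0, a₂₁, 0; -conj a₂₁, 0, 0; 0, 0, 0]

/-- The part of the velocity that mixes the third vector with the first two. -/
noncomputable def offBlockPart (a₃₁ a₃₂ : ℂ) : CMat :=
  !![0, 0, a₃₁; 0, 0, a₃₂; -conj a₃₁, -conj a₃₂, 0]

theorem star_blockPart (a₂₁ : ℂ) : star (blockPart a₂₁) = -blockPart a₂₁ := by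
  ext i j
  fin_cases i <;> fin_cases j <;> simp [blockPart, Matrix.star_apply]

theorem star_geodesicGenerator (α β : ℝ) (a₂₁ a₃₁ a₃₂ : ℂ) :
    star (geodesicGenerator α β a₂₁ a₃₁ a₃₂) = -geodesicGenerator α β a₂₁ a₃₁ a₃₂ := by
  ext i j
  fin_cases i <;> fin_cases j <;> simp [geodesicGenerator, Matrix.star_apply]

theorem geodesicGenerator_eq (α β : ℝ) (a₂₁ a₃₁ a₃₂ : ℂ) :
    geodesicGenerator α β a₂₁ a₃₁ a₃₂
      = (1 / α : ℝ) • blockPart a₂₁ + (1 / β : ℝ) • offBlockPart a₃₁ a₃₂ := by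
  ext i j
  fin_cases i <;> fin_cases j <;> simp [geodesicGenerator, blockPart, offBlockPart]

/-- The embedding of `2 × 2` blocks and scalars as block-diagonal `3 × 3` matrices. -/
def blockDiagHom : Matrix (Fin 2) (Fin 2) ℂ × ℂ →+* CMat where
  toFun p := !![p.1 0 0, p.1 0 1, 0; p.1 1 0, p.1 1 1, 0; 0, 0, p.2]
  map_one' := by ext i j; fin_cases i <;> fin_cases j <;> simp
  map_mul' p q := by
    ext i j
    fin_cases i <;> fin_cases j <;>
      simp [Matrix.mul_apply, Fin.sum_univ_two, Fin.sum_univ_three]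
  map_zero' := by ext i j; fin_cases i <;> fin_cases j <;> simp
  map_add' p q := by ext i j; fin_cases i <;> fin_cases j <;> simp

theorem continuous_blockDiagHom : Continuous blockDiagHom := by
  refine continuous_pi fun i => continuous_pi fun j => ?_
  have h : ∀ i j, Continuous fun p : Matrix (Fin 2) (Fin 2) ℂ × ℂ => p.1 i j := fun i j =>
    (continuous_apply j).comp ((continuous_apply i).comp continuous_fst)
  fin_cases i <;> fin_cases j
  exacts [h 0 0, h 0 1, continuous_const, h 1 0, h 1 1, continuous_const, continuous_const,
    continuous_const, continuous_snd]

/-- The block-diagonal embedding is a continuous ring homomorphism and so commutes with exp; the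
corner 1 is exp 0, and (α - β)/α = 1 - β/α. -/
theorem geodesicG_eq_exp {α : ℝ} (hα : α ≠ 0) (β : ℝ) (a₂₁ : ℂ) (t : ℝ) :
    geodesicG α β a₂₁ t = NormedSpace.exp (((1 - β / α) * t) • blockPart a₂₁) := by
  set X : Matrix (Fin 2) (Fin 2) ℂ := (((α - β) * t : ℝ) : ℂ) •
    !![0, 1 / (α : ℂ) * a₂₁; -(1 / (α : ℂ)) * conj a₂₁, 0] with hX
  have h1 := NormedSpace.map_exp blockDiagHom continuous_blockDiagHom (X, (0 : ℂ))
  have h2 : blockDiagHom (X, 0) = ((1 - β / α) * t) • blockPart a₂₁ := by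
    have hα' : (α : ℂ) ≠ 0 := by exact_mod_cast hα
    ext i j
    fin_cases i <;> fin_cases j <;> simp [blockDiagHom, blockPart, hX] <;> field_simp
  have h3 : blockDiagHom (NormedSpace.exp (X, (0 : ℂ))) = geodesicG α β a₂₁ t := by
    have e1 : (NormedSpace.exp (X, (0 : ℂ))).1 = geodesicBlock α β a₂₁ t := Prod.fst_exp _
    have e2 : (NormedSpace.exp (X, (0 : ℂ))).2 = 1 :=
      (Prod.snd_exp _).trans NormedSpace.exp_zero
    simp only [blockDiagHom, RingHom.coe_mk, MonoidHom.coe_mk, OneHom.coe_mk, geodesicG, e1, e2]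
  exact h3.symm.trans (h1.trans (congrArg _ h2))

variable (α β : ℝ) (a₂₁ a₃₁ a₃₂ : ℂ)

/-- The block-diagonal rotation, as a `3 × 3` exponential. -/
noncomputable def blockRotation (t : ℝ) : CMat :=
  NormedSpace.exp (((1 - β / α) * t) • blockPart a₂₁)

/-- The conserved momentum seen in the moving frame. -/
noncomputable def bodyMomentum (t : ℝ) : CMat :=
  blockRotation α β a₂₁ t * geodesicGenerator α β a₂₁ a₃₁ a₃₂ * star (blockRotation α β a₂₁ t)

/-- The velocity components of the curve given by the geodesic formula. -/
noncomputable def bodyVelocity (t : ℝ) : CMat :=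
  (1 - β / α) • blockPart a₂₁ + β • bodyMomentum α β a₂₁ a₃₁ a₃₂ t

/-- The curve of matrices given by the geodesic formula. -/
noncomputable def geodesicMatrix (t : ℝ) : CMat :=
  blockRotation α β a₂₁ t * NormedSpace.exp ((β * t) • geodesicGenerator α β a₂₁ a₃₁ a₃₂)

theorem frameMatrix_geodesicFormula (hα : α ≠ 0) (u : Fin 3 → EuclideanSpace ℂ (Fin 3)) (t : ℝ) :
    frameMatrix (geodesicFormula α β a₂₁ a₃₁ a₃₂ u t)
      = geodesicMatrix α β a₂₁ a₃₁ a₃₂ t * frameMatrix u := by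
  have h : geodesicMatrix α β a₂₁ a₃₁ a₃₂ t = geodesicG α β a₂₁ t *
      NormedSpace.exp (((β * t : ℝ) : ℂ) • geodesicGenerator α β a₂₁ a₃₁ a₃₂) := by
    rw [geodesicMatrix, geodesicG_eq_exp hα, Complex.coe_smul]
    rfl
  rw [h]
  ext i k
  simp [frameMatrix_apply, geodesicFormula, Matrix.mul_apply (M := geodesicG α β a₂₁ t * _)]

theorem blockRotation_mul_star (t : ℝ) :
    blockRotation α β a₂₁ t * star (blockRotation α β a₂₁ t) = 1 :=
  exp_smul_mul_star (star_blockPart _) _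

theorem star_mul_blockRotation (t : ℝ) :
    star (blockRotation α β a₂₁ t) * blockRotation α β a₂₁ t = 1 :=
  mul_eq_one_comm.1 (blockRotation_mul_star α β a₂₁ t)

theorem geodesicMatrix_mul_star (t : ℝ) :
    geodesicMatrix α β a₂₁ a₃₁ a₃₂ t * star (geodesicMatrix α β a₂₁ a₃₁ a₃₂ t) = 1 := by
  rw [geodesicMatrix, star_mul, mul_assoc, ← mul_assoc (NormedSpace.exp _),
    exp_smul_mul_star (star_geodesicGenerator _ _ _ _ _), one_mul, blockRotation_mul_star]

theorem blockRotation_zero : blockRotation α β a₂₁ 0 = 1 := by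
  rw [blockRotation, mul_zero, zero_smul, NormedSpace.exp_zero]

theorem geodesicMatrix_zero : geodesicMatrix α β a₂₁ a₃₁ a₃₂ 0 = 1 := by
  rw [geodesicMatrix, blockRotation_zero, mul_zero, zero_smul, NormedSpace.exp_zero, one_mul]

theorem contDiff_geodesicMatrix : ContDiff ℝ ∞ (geodesicMatrix α β a₂₁ a₃₁ a₃₂) :=
  ((contDiff_exp_smul _).comp (contDiff_const.mul contDiff_id)).mul
    ((contDiff_exp_smul _).comp (contDiff_const.mul contDiff_id))

theorem hasDerivAt_exp_const_mul_smul (X : CMat) (r t : ℝ) :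
    HasDerivAt (fun s : ℝ => NormedSpace.exp ((r * s) • X))
      (r • X * NormedSpace.exp ((r * t) • X)) t := by
  have h := hasDerivAt_exp_smul_const' (r • X) t
  have e : ∀ s : ℝ, (r * s) • X = s • r • X := fun s => by rw [mul_comm, mul_smul]
  simp only [e]
  exact h

theorem hasDerivAt_blockRotation (t : ℝ) :
    HasDerivAt (blockRotation α β a₂₁)
      ((1 - β / α) • blockPart a₂₁ * blockRotation α β a₂₁ t) t :=
  hasDerivAt_exp_const_mul_smul _ _ _

theorem hasDerivAt_star_blockRotation (t : ℝ) :
    HasDerivAt (fun s => star (blockRotation α β a₂₁ s))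
      (-(star (blockRotation α β a₂₁ t) * ((1 - β / α) • blockPart a₂₁))) t := by
  have h := (hasDerivAt_blockRotation α β a₂₁ t).star
  have e : star ((1 - β / α) • blockPart a₂₁ * blockRotation α β a₂₁ t)
      = -(star (blockRotation α β a₂₁ t) * ((1 - β / α) • blockPart a₂₁)) := by
    rw [star_mul, star_smul, star_blockPart, smul_neg, mul_neg]
    rfl
  exact h.congr_deriv e

/-- The left factor contributes its constant generator; the generator of the right factor, moved to
the left through the rotation, becomes the conjugated momentum. -/
theorem hasDerivAt_geodesicMatrix (t : ℝ) :
    HasDerivAt (geodesicMatrix α β a₂₁ a₃₁ a₃₂)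
      (bodyVelocity α β a₂₁ a₃₁ a₃₂ t * geodesicMatrix α β a₂₁ a₃₁ a₃₂ t) t := by
  have h := (hasDerivAt_blockRotation α β a₂₁ t).mul
    (hasDerivAt_exp_const_mul_smul (geodesicGenerator α β a₂₁ a₃₁ a₃₂) β t)
  have e : (1 - β / α) • blockPart a₂₁ * blockRotation α β a₂₁ t *
        NormedSpace.exp ((β * t) • geodesicGenerator α β a₂₁ a₃₁ a₃₂)
      + blockRotation α β a₂₁ t * (β • geodesicGenerator α β a₂₁ a₃₁ a₃₂ *
        NormedSpace.exp ((β * t) • geodesicGenerator α β a₂₁ a₃₁ a₃₂))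
      = bodyVelocity α β a₂₁ a₃₁ a₃₂ t * geodesicMatrix α β a₂₁ a₃₁ a₃₂ t := by
    rw [bodyVelocity, add_mul, geodesicMatrix, bodyMomentum]
    congr 1
    · simp only [mul_assoc]
    · rw [← mul_assoc, smul_mul_assoc, ← mul_assoc, mul_assoc _ (star _), star_mul_blockRotation,
        mul_one, mul_smul_comm, smul_mul_assoc]
  exact h.congr_deriv e

theorem hasDerivAt_bodyMomentum (t : ℝ) :
    HasDerivAt (bodyMomentum α β a₂₁ a₃₁ a₃₂)
      ((1 - β / α) • blockPart a₂₁ * bodyMomentum α β a₂₁ a₃₁ a₃₂ t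
        - bodyMomentum α β a₂₁ a₃₁ a₃₂ t * ((1 - β / α) • blockPart a₂₁)) t := by
  have h := ((hasDerivAt_blockRotation α β a₂₁ t).mul_const
    (geodesicGenerator α β a₂₁ a₃₁ a₃₂)).mul (hasDerivAt_star_blockRotation α β a₂₁ t)
  refine h.congr_deriv ?_
  rw [bodyMomentum]
  noncomm_ring

/-- Conjugation by the block rotation preserves the matrices that mix only the third vector with
the first two. -/
theorem offBlock_conj (t : ℝ) (i j : Fin 3) (h : (i = 2) ↔ (j = 2)) :
    (blockRotation α β a₂₁ t * offBlockPart a₃₁ a₃₂ * star (blockRotation α β a₂₁ t)) i j = 0 := by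
  -- Parity argument: S commutes with the rotation and anticommutes with the off-block part, hence
  -- anticommutes with the conjugate; entries where the signs of S agree must vanish.
  set S : CMat := Matrix.diagonal ![1, 1, -1] with hS
  have hb : Commute S (blockPart a₂₁) := by
    ext i j
    rw [Matrix.diagonal_mul, Matrix.mul_diagonal]
    fin_cases i <;> fin_cases j <;> simp [blockPart]
  have hP : Commute S (blockRotation α β a₂₁ t) := (hb.smul_right _).exp_right
  have hS' : star S = S := by
    rw [hS, Matrix.star_eq_conjTranspose, Matrix.diagonal_conjTranspose]
    congr 1
    ext i
    fin_cases i <;> simp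
  have hP' : Commute S (star (blockRotation α β a₂₁ t)) := by
    have := hP.star_star
    rwa [hS'] at this
  have hh : S * offBlockPart a₃₁ a₃₂ = -(offBlockPart a₃₁ a₃₂ * S) := by
    ext i j
    rw [Matrix.neg_apply, Matrix.diagonal_mul, Matrix.mul_diagonal]
    fin_cases i <;> fin_cases j <;> simp [offBlockPart]
  set H := blockRotation α β a₂₁ t * offBlockPart a₃₁ a₃₂ * star (blockRotation α β a₂₁ t) with hH
  have key : S * H = -(H * S) := by
    rw [hH, ← mul_assoc, ← mul_assoc, hP.eq, mul_assoc (blockRotation α β a₂₁ t), hh, mul_neg,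
      neg_mul, mul_assoc _ (star _), ← hP'.eq]
    simp only [mul_assoc]
  have h2 := congrFun (congrFun key i) j
  rw [Matrix.neg_apply, Matrix.diagonal_mul, Matrix.mul_diagonal] at h2
  fin_cases i <;> fin_cases j <;> simp at h h2 ⊢ <;>
    first | exact self_eq_neg.1 h2 | exact self_eq_neg.1 h2.symm

theorem bodyMomentum_eq (t : ℝ) :
    bodyMomentum α β a₂₁ a₃₁ a₃₂ t = (1 / α : ℝ) • blockPart a₂₁ + (1 / β : ℝ) •
      (blockRotation α β a₂₁ t * offBlockPart a₃₁ a₃₂ * star (blockRotation α β a₂₁ t)) := by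
  have hc : Commute (blockPart a₂₁) (blockRotation α β a₂₁ t) :=
    ((Commute.refl (blockPart a₂₁)).smul_right _).exp_right
  rw [bodyMomentum, geodesicGenerator_eq, mul_add, add_mul, mul_smul_comm, mul_smul_comm,
    smul_mul_assoc, smul_mul_assoc, ← hc.eq, mul_assoc (blockPart a₂₁), blockRotation_mul_star,
    mul_one]

variable {α β}

/-- The two block contributions add up to (1 - β/α) + β/α = 1. This is what fixes the time factor α
- β in the formula. -/
theorem bodyVelocity_eq (hβ : β ≠ 0) (t : ℝ) :
    bodyVelocity α β a₂₁ a₃₁ a₃₂ t = blockPart a₂₁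
      + blockRotation α β a₂₁ t * offBlockPart a₃₁ a₃₂ * star (blockRotation α β a₂₁ t) := by
  rw [bodyVelocity, bodyMomentum_eq, smul_add, smul_smul, smul_smul, ← add_assoc, ← add_smul,
    mul_one_div_cancel hβ, one_smul]
  have : 1 - β / α + β * (1 / α) = 1 := by ring
  rw [this, one_smul]

theorem bodyVelocity_diag (hβ : β ≠ 0) (t : ℝ) (i : Fin 3) :
    bodyVelocity α β a₂₁ a₃₁ a₃₂ t i i = 0 := by
  rw [bodyVelocity_eq _ _ _ hβ, Matrix.add_apply, offBlock_conj _ _ _ _ _ _ _ _ Iff.rfl,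
    add_zero]
  fin_cases i <;> simp [blockPart]

/-- The rotated off-block part remains off-block, so inertia divides the two summands of the
velocity by α and β separately. -/
theorem flagInertia_bodyVelocity (hβ : β ≠ 0) (t : ℝ) :
    flagInertia α β (bodyVelocity α β a₂₁ a₃₁ a₃₂ t) = bodyMomentum α β a₂₁ a₃₁ a₃₂ t := by
  rw [bodyVelocity_eq _ _ _ hβ, bodyMomentum_eq]
  have h := offBlock_conj α β a₂₁ a₃₁ a₃₂ t
  ext i j
  fin_cases i <;> fin_cases j <;> simp [flagInertia_apply, blockPart, h]

theorem bodyVelocity_zero (hβ : β ≠ 0) :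
    bodyVelocity α β a₂₁ a₃₁ a₃₂ 0 = blockPart a₂₁ + offBlockPart a₃₁ a₃₂ := by
  rw [bodyVelocity_eq _ _ _ hβ, blockRotation_zero, star_one, one_mul, mul_one]

theorem hasDerivAt_bodyVelocity (t : ℝ) :
    HasDerivAt (bodyVelocity α β a₂₁ a₃₁ a₃₂)
      (β • ((1 - β / α) • blockPart a₂₁ * bodyMomentum α β a₂₁ a₃₁ a₃₂ t
        - bodyMomentum α β a₂₁ a₃₁ a₃₂ t * ((1 - β / α) • blockPart a₂₁))) t :=
  ((hasDerivAt_bodyMomentum α β a₂₁ a₃₁ a₃₂ t).const_smul β).const_add _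

/-- The curve given by the geodesic formula satisfies the Euler-Lagrange equation. -/
theorem eulerDefect_bodyVelocity (hβ : β ≠ 0) (t : ℝ) :
    eulerDefect α β (bodyVelocity α β a₂₁ a₃₁ a₃₂ t)
      (deriv (bodyVelocity α β a₂₁ a₃₁ a₃₂) t) = 0 := by
  have h1 : HasDerivAt (fun s => flagInertia α β (bodyVelocity α β a₂₁ a₃₁ a₃₂ s))
      (flagInertia α β (deriv (bodyVelocity α β a₂₁ a₃₁ a₃₂) t)) t :=
    (flagInertia α β).hasFDerivAt.comp_hasDerivAt t
      (hasDerivAt_bodyVelocity a₂₁ a₃₁ a₃₂ t).differentiableAt.hasDerivAt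
  have h2 : flagInertia α β (deriv (bodyVelocity α β a₂₁ a₃₁ a₃₂) t) = _ :=
    h1.unique ((hasDerivAt_bodyMomentum α β a₂₁ a₃₁ a₃₂ t).congr_of_eventuallyEq
      (Filter.Eventually.of_forall fun s => flagInertia_bodyVelocity a₂₁ a₃₁ a₃₂ hβ s))
  -- The momentum commutes with its own multiple inside the velocity, so only the constant generator
  -- is left in the commutator.
  rw [eulerDefect, h2, flagInertia_bodyVelocity _ _ _ hβ, bodyVelocity, add_mul, mul_add,
    smul_mul_assoc β, mul_smul_comm β]
  abel

end Formula

/-! ### Integration of the Euler-Lagrange equation in the gauge. -/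

section Solution

attribute [local instance] Matrix.linftyOpNormedRing Matrix.linftyOpNormedAlgebra
attribute [local instance] continuousStar_linftyOp

theorem frameVelocity_eq_frameOmega {u : ℝ → UnitaryFrame} {I : Set ℝ} (hI : IsOpen I)
    (hu : ContDiffOn ℝ ∞ (fun t => (u t).1) I) {t : ℝ} (ht : t ∈ I) (i j : Fin 3) :
    frameVelocity u i j t = frameOmega u t j i := by
  have hd : DifferentiableAt ℝ (fun τ => (u τ).1) t :=
    (hu.contDiffAt (hI.mem_nhds ht)).differentiableAt (by simp)
  have h1 : deriv (fun τ => (u τ).1 j) t = deriv (fun τ => (u τ).1) t j :=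
    ((hasDerivAt_pi.1 hd.hasDerivAt) j).deriv
  have h2 : frameMatrix (deriv (fun τ => (u τ).1) t) = deriv (fun τ => frameMatrix (u τ).1) t := by
    have := frameMatrix_derivWithin (fun τ => (u τ).1) (uniqueDiffWithinAt_univ (x := t))
    rw [derivWithin_univ] at this
    exact this.trans (congrFun derivWithin_univ t)
  rw [frameVelocity, h1, inner_eq_frameMatrix, h2]
  rfl

theorem eq_of_hasDerivAt_zero {I : Set ℝ} (hI : IsOpen I) (hIc : I.OrdConnected) {f : ℝ → CMat}
    (hf : ∀ t ∈ I, HasDerivAt f 0 t) {s t : ℝ} (hs : s ∈ I) (ht : t ∈ I) : f s = f t :=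
  hI.is_const_of_deriv_eq_zero hIc.isPreconnected
    (fun τ hτ => (hf τ hτ).differentiableAt.differentiableWithinAt)
    (fun τ hτ => (hf τ hτ).deriv) hs ht

/-- Frames with the same velocity components differ by a constant matrix. -/
theorem eqOn_of_same_velocity {I : Set ℝ} (hI : IsOpen I) (hIc : I.OrdConnected) {Y U Ω : ℝ → CMat}
    (hY : ∀ t ∈ I, HasDerivAt Y (Ω t * Y t) t) (hU : ∀ t ∈ I, HasDerivAt U (Ω t * U t) t)
    (hΩ : ∀ t ∈ I, star (Ω t) = -Ω t) (hYu : ∀ t ∈ I, Y t * star (Y t) = 1) {t₀ : ℝ} (ht₀ : t₀ ∈ I)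
    (h0 : Y t₀ = U t₀) {t : ℝ} (ht : t ∈ I) : U t = Y t := by
  have hZ : ∀ t ∈ I, HasDerivAt (fun s => star (Y s) * U s) 0 t := fun t ht => by
    have e : star (Ω t * Y t) * U t + star (Y t) * (Ω t * U t) = 0 := by
      rw [star_mul, hΩ t ht]
      noncomm_ring
    exact ((hY t ht).star.mul (hU t ht)).congr_deriv e
  have h1 : star (Y t) * U t = 1 := by
    have h2 := eq_of_hasDerivAt_zero hI hIc hZ ht ht₀
    rw [h2, ← h0]
    exact mul_eq_one_comm.1 (hYu t₀ ht₀)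
  calc U t = Y t * star (Y t) * U t := by rw [hYu t ht, one_mul]
    _ = Y t := by rw [mul_assoc, h1, mul_one]

theorem apply_eq_of_deriv_apply_eq_zero {I : Set ℝ} (hI : IsOpen I) (hIc : I.OrdConnected)
    {f : ℝ → CMat} (hf : ∀ t ∈ I, DifferentiableAt ℝ f t) {i j : Fin 3}
    (h : ∀ t ∈ I, deriv f t i j = 0) {s t : ℝ} (hs : s ∈ I) (ht : t ∈ I) : f s i j = f t i j := by
  let e : CMat →L[ℝ] ℂ := LinearMap.toContinuousLinearMap
    { toFun := fun X => X i j
      map_add' := fun _ _ => rfl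
      map_smul' := fun _ _ => rfl }
  have hd : ∀ τ ∈ I, HasDerivAt (fun τ => e (f τ)) 0 τ := fun τ hτ =>
    (e.hasFDerivAt.comp_hasDerivAt τ (hf τ hτ).hasDerivAt).congr_deriv (h τ hτ)
  exact hI.is_const_of_deriv_eq_zero hIc.isPreconnected (f := fun τ => e (f τ))
    (fun τ hτ => (hd τ hτ).differentiableAt.differentiableWithinAt)
    (fun τ hτ => (hd τ hτ).deriv) hs ht

/-- In the gauge with vanishing diagonal, the Euler-Lagrange equation is solved by the formula. -/
theorem bodyVelocity_of_eulerDefect {α β : ℝ} (hα : α ≠ 0) (hβ : β ≠ 0) {I : Set ℝ}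
    (hI : IsOpen I) (hIc : I.OrdConnected) (hI0 : (0 : ℝ) ∈ I) {Ω : ℝ → CMat}
    (hd : ∀ t ∈ I, DifferentiableAt ℝ Ω t) (hskew : ∀ t ∈ I, star (Ω t) = -Ω t)
    (hdiag : ∀ t ∈ I, ∀ i, Ω t i i = 0)
    (hE : ∀ t ∈ I, eulerDefect α β (Ω t) (deriv Ω t) = 0) {t : ℝ} (ht : t ∈ I) :
    Ω t = bodyVelocity α β (Ω 0 0 1) (Ω 0 0 2) (Ω 0 1 2) t := by
  have hα' : (α : ℂ) ≠ 0 := by exact_mod_cast hα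
  have hβ' : (β : ℂ) ≠ 0 := by exact_mod_cast hβ
  have hs : ∀ t ∈ I, ∀ i j, Ω t i j = -conj (Ω t j i) := fun t ht i j => by
    have h1 := congrArg conj (congrFun (congrFun (hskew t ht) j) i)
    rw [Matrix.star_apply, Matrix.neg_apply] at h1
    simpa using h1
  have h01 : ∀ t ∈ I, Ω t 0 1 = Ω 0 0 1 := fun t ht =>
    apply_eq_of_deriv_apply_eq_zero hI hIc hd (fun τ hτ => by
      have h1 := congrFun (congrFun (hE τ hτ) 0) 1
      have d := hdiag τ hτ
      simp only [eulerDefect, Matrix.sub_apply, Matrix.mul_apply, Fin.sum_univ_three,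
        flagInertia_apply] at h1
      simp [d] at h1
      -- The products of the entries `(0, 2)` and `(2, 1)` carry the same factor 1/β in both terms
      -- of the commutator and cancel.
      have h2 : (α : ℂ)⁻¹ * deriv Ω τ 0 1 = 0 := by linear_combination h1
      exact (mul_eq_zero.1 h2).resolve_left (inv_ne_zero hα')) ht hI0
  set b := (1 - β / α) • blockPart (Ω 0 0 1) with hb
  have hsplit : ∀ t ∈ I, Ω t = b + β • flagInertia α β (Ω t) := fun t ht => by
    have d := hdiag t ht
    have e := h01 t ht
    have e' : Ω t 1 0 = -conj (Ω 0 0 1) := by rw [hs t ht, e]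
    ext i j
    fin_cases i <;> fin_cases j <;> simp [hb, flagInertia_apply, blockPart, d, e, e', hβ'] <;> ring
  have hL : ∀ t ∈ I, HasDerivAt (fun s => flagInertia α β (Ω s))
      (b * flagInertia α β (Ω t) - flagInertia α β (Ω t) * b) t := fun t ht => by
    have e : flagInertia α β (deriv Ω t)
        = b * flagInertia α β (Ω t) - flagInertia α β (Ω t) * b := by
      rw [sub_eq_zero.1 (hE t ht)]
      -- Only the two bare factors Ω are split, not those inside the inertia; the first rewriting
      -- creates a new occurrence, so the second bare factor is then the fourth.
      nth_rewrite 1 [hsplit t ht]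
      nth_rewrite 4 [hsplit t ht]
      rw [add_mul, mul_add, smul_mul_assoc β, mul_smul_comm β]
      abel
    exact ((flagInertia α β).hasFDerivAt.comp_hasDerivAt t (hd t ht).hasDerivAt).congr_deriv e
  set P := blockRotation α β (Ω 0 0 1) with hP
  have hPP : ∀ t, P t * star (P t) = 1 := blockRotation_mul_star α β _
  -- Seen after undoing the rotation, the momentum is conserved.
  have hR : ∀ t ∈ I, HasDerivAt (fun s => star (P s) * flagInertia α β (Ω s) * P s) 0 t :=
    fun t ht => by
      have h1 := ((hasDerivAt_star_blockRotation α β (Ω 0 0 1) t).mul (hL t ht)).mul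
        (hasDerivAt_blockRotation α β (Ω 0 0 1) t)
      have e : (-(star (P t) * b) * flagInertia α β (Ω t)
          + star (P t) * (b * flagInertia α β (Ω t) - flagInertia α β (Ω t) * b)) * P t
          + star (P t) * flagInertia α β (Ω t) * (b * P t) = 0 := by noncomm_ring
      exact h1.congr_deriv e
  have hR0 := eq_of_hasDerivAt_zero hI hIc hR ht hI0
  have hM : flagInertia α β (Ω 0) = geodesicGenerator α β (Ω 0 0 1) (Ω 0 0 2) (Ω 0 1 2) := by
    have e := hs 0 hI0
    ext i j
    fin_cases i <;> fin_cases j <;>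
      simp [flagInertia_apply, geodesicGenerator, e 1 0, e 2 0, e 2 1]
  have hP0 : P 0 = 1 := blockRotation_zero α β _
  rw [hP0, star_one, one_mul, mul_one, hM] at hR0
  rw [hsplit t ht, bodyVelocity, bodyMomentum, ← hR0, ← hP, ← hb]
  congr 2
  calc flagInertia α β (Ω t)
      = (P t * star (P t)) * flagInertia α β (Ω t) * (P t * star (P t)) := by
        rw [hPP, one_mul, mul_one]
    _ = _ := by noncomm_ring

theorem geodesicFormula_iff {α β : ℝ} (hα : α ≠ 0) (u : UnitaryFrame) (v : UnitaryFrame)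
    (a₂₁ a₃₁ a₃₂ : ℂ) (t : ℝ) : v.1 = geodesicFormula α β a₂₁ a₃₁ a₃₂ u.1 t ↔
      frameMatrix v.1 = geodesicMatrix α β a₂₁ a₃₁ a₃₂ t * frameMatrix u.1 := by
  rw [← frameMatrix_geodesicFormula α β _ _ _ hα, frameMatrix.injective.eq_iff]

theorem hasDerivAt_geodesicMatrix_mul (α β : ℝ) (a₂₁ a₃₁ a₃₂ : ℂ) (U : CMat) (t : ℝ) :
    HasDerivAt (fun s => geodesicMatrix α β a₂₁ a₃₁ a₃₂ s * U)
      (bodyVelocity α β a₂₁ a₃₁ a₃₂ t * (geodesicMatrix α β a₂₁ a₃₁ a₃₂ t * U)) t := by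
  refine ((hasDerivAt_geodesicMatrix α β a₂₁ a₃₁ a₃₂ t).mul_const U).congr_deriv ?_
  rw [mul_assoc]

/-- The velocity components of a curve of frames given by the formula. -/
theorem frameOmega_of_formula {α β : ℝ} {u : ℝ → UnitaryFrame} {I : Set ℝ}
    (hI : IsOpen I) {U : CMat} {a₂₁ a₃₁ a₃₂ : ℂ}
    (h : ∀ t ∈ I, frameMatrix (u t).1 = geodesicMatrix α β a₂₁ a₃₁ a₃₂ t * U)
    {t : ℝ} (ht : t ∈ I) : frameOmega u t = bodyVelocity α β a₂₁ a₃₁ a₃₂ t := by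
  have h1 : HasDerivAt (fun s => frameMatrix (u s).1)
      (bodyVelocity α β a₂₁ a₃₁ a₃₂ t * frameMatrix (u t).1) t := by
    rw [h t ht]
    refine (hasDerivAt_geodesicMatrix_mul α β a₂₁ a₃₁ a₃₂ U t).congr_of_eventuallyEq ?_
    filter_upwards [hI.mem_nhds ht] with s hs using h s hs
  refine (congrArg (· * star (frameMatrix (u t).1)) h1.deriv).trans ?_
  simp only [mul_assoc, frameMatrix_mul_star, mul_one]

theorem eulerDefect_of_formula {α β : ℝ} (hβ : β ≠ 0) {u : ℝ → UnitaryFrame} {I : Set ℝ}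
    (hI : IsOpen I) {U : CMat} {a₂₁ a₃₁ a₃₂ : ℂ}
    (h : ∀ t ∈ I, frameMatrix (u t).1 = geodesicMatrix α β a₂₁ a₃₁ a₃₂ t * U)
    {t : ℝ} (ht : t ∈ I) : eulerDefect α β (frameOmega u t) (deriv (frameOmega u) t) = 0 := by
  have h1 : deriv (frameOmega u) t = deriv (bodyVelocity α β a₂₁ a₃₁ a₃₂) t := by
    refine Filter.EventuallyEq.deriv_eq ?_
    filter_upwards [hI.mem_nhds ht] with s hs using frameOmega_of_formula hI h hs
  rw [h1, frameOmega_of_formula hI h ht, eulerDefect_bodyVelocity _ _ _ hβ]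

/-- A gauge-fixed curve over a geodesic is given by the formula. -/
theorem IsGaugeFixedOn.eq_geodesicFormula {α β : ℝ} (hα : α ≠ 0) (hβ : β ≠ 0)
    {I : Set ℝ} (hI : IsOpen I) (hIc : I.OrdConnected) (hI0 : (0 : ℝ) ∈ I) {u : ℝ → UnitaryFrame}
    (hu : IsGaugeFixedOn u I) {c : ℝ → FlagManifold} (hc : ∀ t ∈ I, (u t).toFlag = c t)
    (hg : IsFlagGeodesicOn α β β c I) {t : ℝ} (ht : t ∈ I) :
    (u t).1 = geodesicFormula α β (frameVelocity u 1 0 0) (frameVelocity u 2 0 0)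
      (frameVelocity u 2 1 0) (u 0).1 t := by
  rw [geodesicFormula_iff hα]
  simp only [frameVelocity_eq_frameOmega hI hu.smooth hI0]
  have hΩ : ∀ t ∈ I, frameOmega u t = bodyVelocity α β (frameOmega u 0 0 1) (frameOmega u 0 0 2)
      (frameOmega u 0 1 2) t := fun t ht =>
    bodyVelocity_of_eulerDefect hα hβ hI hIc hI0
      (fun t ht => (hasDerivAt_frameOmega hI hu.smooth ht).differentiableAt)
      (fun t ht => star_frameOmega hI hu.smooth ht)
      (fun t ht i => by rw [← frameVelocity_eq_frameOmega hI hu.smooth ht, hu.gauge t ht])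
      (fun t ht => hg.eulerDefect_eq_zero hI hu.smooth hc ht) ht
  refine eqOn_of_same_velocity hI hIc (Ω := frameOmega u)
    (Y := fun s => geodesicMatrix α β (frameOmega u 0 0 1) (frameOmega u 0 0 2)
      (frameOmega u 0 1 2) s * frameMatrix (u 0).1) (U := fun s => frameMatrix (u s).1)
    (fun t ht => ?_) (fun t ht => hasDerivAt_frameMatrix hI hu.smooth ht)
    (fun t ht => star_frameOmega hI hu.smooth ht) (fun t _ => ?_) hI0 ?_ ht
  · rw [hΩ t ht]
    exact hasDerivAt_geodesicMatrix_mul α β _ _ _ _ t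
  · rw [star_mul, mul_assoc, ← mul_assoc (frameMatrix _), frameMatrix_mul_star, one_mul,
      geodesicMatrix_mul_star]
  · simp only [geodesicMatrix_zero, one_mul]

/-- A smooth curve of frames given by the formula represents a geodesic. -/
theorem isFlagGeodesicOn_of_formula {α β : ℝ} (hα : α ≠ 0) (hβ : β ≠ 0) {I : Set ℝ}
    (hI : IsOpen I) {u : ℝ → UnitaryFrame} (hu : ContDiffOn ℝ ∞ (fun t => (u t).1) I)
    {u₀ : UnitaryFrame} {a₂₁ a₃₁ a₃₂ : ℂ}
    (h : ∀ t ∈ I, (u t).1 = geodesicFormula α β a₂₁ a₃₁ a₃₂ u₀.1 t) :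
    IsFlagGeodesicOn α β β (fun t => (u t).toFlag) I :=
  isFlagGeodesicOn_of_eulerDefect hI hu (fun _ _ => rfl) fun _ ht =>
    eulerDefect_of_formula hβ hI (fun s hs => (geodesicFormula_iff hα _ _ _ _ _ _).1 (h s hs)) ht

/-- All initial data are attained by the formula. -/
theorem exists_geodesic_of_initial_data {α β : ℝ} (hα : α ≠ 0) (hβ : β ≠ 0) (u₀ : UnitaryFrame)
    (a₂₁ a₃₁ a₃₂ : ℂ) :
    ∃ u : ℝ → UnitaryFrame, u 0 = u₀ ∧ IsGaugeFixedOn u univ ∧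
      frameVelocity u 1 0 0 = a₂₁ ∧ frameVelocity u 2 0 0 = a₃₁ ∧ frameVelocity u 2 1 0 = a₃₂ ∧
      (∀ t, (u t).1 = geodesicFormula α β a₂₁ a₃₁ a₃₂ u₀.1 t) ∧
      IsFlagGeodesicOn α β β (fun t => (u t).toFlag) univ := by
  set Y : ℝ → CMat := fun t => geodesicMatrix α β a₂₁ a₃₁ a₃₂ t * frameMatrix u₀.1 with hY
  have hYu : ∀ t, Y t * star (Y t) = 1 := fun t => by
    rw [hY, star_mul, mul_assoc, ← mul_assoc (frameMatrix _), frameMatrix_mul_star, one_mul,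
      geodesicMatrix_mul_star]
  set u : ℝ → UnitaryFrame := fun t => matrixFrame (Y t) (hYu t) with hu
  have hm : ∀ t, frameMatrix (u t).1 = Y t := fun t => frameMatrix_matrixFrame _ _
  have hs : ContDiffOn ℝ ∞ (fun t => (u t).1) univ := by
    rw [← contDiffOn_frameMatrix]
    simp only [hm]
    exact ((contDiff_geodesicMatrix α β a₂₁ a₃₁ a₃₂).mul contDiff_const).contDiffOn
  have hΩ : ∀ t, frameOmega u t = bodyVelocity α β a₂₁ a₃₁ a₃₂ t := fun t =>
    frameOmega_of_formula isOpen_univ (fun s _ => hm s) (mem_univ t)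
  have hv : ∀ i j t, frameVelocity u i j t = bodyVelocity α β a₂₁ a₃₁ a₃₂ t j i := fun i j t => by
    rw [frameVelocity_eq_frameOmega isOpen_univ hs (mem_univ t), hΩ]
  have hform : ∀ t, (u t).1 = geodesicFormula α β a₂₁ a₃₁ a₃₂ u₀.1 t := fun t =>
    (geodesicFormula_iff hα _ _ _ _ _ _).2 (hm t)
  refine ⟨u, ?_, ⟨hs, fun t _ i => ?_⟩, ?_, ?_, ?_, hform,
    isFlagGeodesicOn_of_formula hα hβ isOpen_univ hs fun t _ => hform t⟩
  · refine frameMatrix_injective ((hm 0).trans ?_)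
    simp only [hY, geodesicMatrix_zero, one_mul]
  · rw [hv, bodyVelocity_diag _ _ _ hβ]
  all_goals
    rw [hv, bodyVelocity_zero _ _ _ hβ]
    simp [blockPart, offBlockPart]

end Solution

/-! ### Gauge-fixed lifts of smooth flag curves. -/

section Lifting

attribute [local instance] Matrix.linftyOpNormedRing Matrix.linftyOpNormedAlgebra
attribute [local instance] continuousStar_linftyOp

theorem IsGaugeFixedOn.frameOmega_diag {u : ℝ → UnitaryFrame} {J : Set ℝ} (hJ : IsOpen J)
    (hu : IsGaugeFixedOn u J) {t : ℝ} (ht : t ∈ J) (i : Fin 3) : frameOmega u t i i = 0 := by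
  rw [← frameVelocity_eq_frameOmega hJ hu.smooth ht, hu.gauge t ht]

theorem isGaugeFixedOn_of_matrix {Y Ω : ℝ → CMat} (hYu : ∀ t, Y t * star (Y t) = 1) {J : Set ℝ}
    (hJ : IsOpen J) (hY : ContDiffOn ℝ ∞ Y J) (hd : ∀ t ∈ J, HasDerivAt Y (Ω t * Y t) t)
    (hΩ : ∀ t ∈ J, ∀ i, Ω t i i = 0) : IsGaugeFixedOn (fun t => matrixFrame (Y t) (hYu t)) J := by
  have hs : ContDiffOn ℝ ∞ (fun t => (matrixFrame (Y t) (hYu t)).1) J := by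
    rw [← contDiffOn_frameMatrix]
    simpa only [frameMatrix_matrixFrame] using hY
  refine ⟨hs, fun t ht i => ?_⟩
  have h1 : HasDerivAt (fun s => frameMatrix (matrixFrame (Y s) (hYu s)).1) (Ω t * Y t) t := by
    simpa only [frameMatrix_matrixFrame] using hd t ht
  have h2 : frameOmega (fun t => matrixFrame (Y t) (hYu t)) t = Ω t := by
    refine (congrArg (· * star (frameMatrix (matrixFrame (Y t) (hYu t)).1)) h1.deriv).trans ?_
    simp only [frameMatrix_matrixFrame, mul_assoc, hYu, mul_one]
  rw [frameVelocity_eq_frameOmega hJ hs ht, h2, hΩ t ht]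

theorem IsGaugeFixedOn.mono {u : ℝ → UnitaryFrame} {J K : Set ℝ} (hu : IsGaugeFixedOn u J)
    (h : K ⊆ J) : IsGaugeFixedOn u K :=
  ⟨hu.smooth.mono h, fun t ht => hu.gauge t (h ht)⟩

theorem IsGaugeFixedOn.congr {u v : ℝ → UnitaryFrame} {J : Set ℝ} (hJ : IsOpen J)
    (hu : IsGaugeFixedOn u J) (h : EqOn v u J) : IsGaugeFixedOn v J := by
  refine ⟨hu.smooth.congr fun t ht => by rw [h ht], fun t ht i => ?_⟩
  have h1 : (fun τ => (v τ).1 i) =ᶠ[nhds t] fun τ => (u τ).1 i := by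
    filter_upwards [hJ.mem_nhds ht] with s hs
    rw [h hs]
  rw [frameVelocity, h1.deriv_eq, h ht]
  exact hu.gauge t ht i

theorem isGaugeFixedOn_of_forall_nhds {u : ℝ → UnitaryFrame} {S : Set ℝ}
    (h : ∀ t ∈ S, ∃ K : Set ℝ, IsOpen K ∧ t ∈ K ∧ IsGaugeFixedOn u K) : IsGaugeFixedOn u S := by
  refine ⟨fun t ht => ?_, fun t ht => ?_⟩
  · obtain ⟨K, hK, htK, hu⟩ := h t ht
    exact (hu.smooth.contDiffAt (hK.mem_nhds htK)).contDiffWithinAt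
  · obtain ⟨K, hK, htK, hu⟩ := h t ht
    exact hu.gauge t htK

/-- Gauge-fixed lifts are determined by one value. -/
theorem IsGaugeFixedOn.eqOn {u v : ℝ → UnitaryFrame} {J : Set ℝ} (hJ : IsOpen J)
    (hJc : J.OrdConnected) (hu : IsGaugeFixedOn u J) (hv : IsGaugeFixedOn v J)
    (h : ∀ t ∈ J, (u t).toFlag = (v t).toFlag) {t₁ : ℝ} (ht₁ : t₁ ∈ J) (h₁ : u t₁ = v t₁) :
    EqOn u v J := by
  intro t ht
  set D : ℝ → CMat := fun s => frameMatrix (v s).1 * star (frameMatrix (u s).1) with hD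
  have hDd : ∀ s ∈ J, (D s).IsDiag := fun s hs => isDiag_mul_star_of_toFlag_eq (h s hs)
  have hD' : ∀ s ∈ J, HasDerivAt D 0 s := fun s hs => by
    have h1 : HasDerivAt D (frameOmega v s * D s - D s * frameOmega u s) s := by
      have e : frameOmega v s * frameMatrix (v s).1 * star (frameMatrix (u s).1)
          + frameMatrix (v s).1 * star (frameOmega u s * frameMatrix (u s).1)
          = frameOmega v s * D s - D s * frameOmega u s := by
        rw [star_mul, star_frameOmega hJ hu.smooth hs, hD]
        noncomm_ring
      exact ((hasDerivAt_frameMatrix hJ hv.smooth hs).mul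
        (hasDerivAt_frameMatrix hJ hu.smooth hs).star).congr_deriv e
    have h2 := isDiag_of_hasDerivWithinAt (hJ.uniqueDiffWithinAt hs) hs hDd h1.hasDerivWithinAt
    -- Off the diagonal this vanishes as the derivative of a diagonal matrix; on the diagonal it
    -- vanishes because both velocities have zero diagonal.
    have h3 : frameOmega v s * D s - D s * frameOmega u s = 0 := by
      ext i j
      by_cases hij : i = j
      · subst hij
        rw [← (hDd s hs).diagonal_diag, Matrix.sub_apply, Matrix.mul_diagonal,
          Matrix.diagonal_mul, hu.frameOmega_diag hJ hs, hv.frameOmega_diag hJ hs]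
        simp
      · exact h2 hij
    exact h1.congr_deriv h3
  have h4 : D t = 1 := by
    rw [eq_of_hasDerivAt_zero hJ hJc hD' ht ht₁]
    simp only [hD, h₁, frameMatrix_mul_star]
  refine (frameMatrix_injective ?_).symm
  calc frameMatrix (v t).1 = D t * frameMatrix (u t).1 := by
        rw [hD, mul_assoc, star_mul_frameMatrix, mul_one]
    _ = _ := by rw [h4, one_mul]

/-- The value of a gauge-fixed lift at one point can be prescribed. -/
theorem IsGaugeFixedOn.exists_rotate {u : ℝ → UnitaryFrame} {J : Set ℝ} (hJ : IsOpen J)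
    (hu : IsGaugeFixedOn u J) {t₁ : ℝ} {w : UnitaryFrame}
    (hw : (u t₁).toFlag = w.toFlag) :
    ∃ v : ℝ → UnitaryFrame, IsGaugeFixedOn v J ∧ v t₁ = w ∧ ∀ t, (v t).toFlag = (u t).toFlag := by
  set D : CMat := frameMatrix w.1 * star (frameMatrix (u t₁).1) with hD
  have hDd : D.IsDiag := isDiag_mul_star_of_toFlag_eq hw
  have hDu : D * star D = 1 := by
    rw [hD, star_mul, star_star, mul_assoc, ← mul_assoc (star _), star_mul_frameMatrix, one_mul,
      frameMatrix_mul_star]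
  have hYu : ∀ t, D * frameMatrix (u t).1 * star (D * frameMatrix (u t).1) = 1 := fun t => by
    rw [star_mul, mul_assoc, ← mul_assoc (frameMatrix _), frameMatrix_mul_star, one_mul, hDu]
  refine ⟨fun t => matrixFrame (D * frameMatrix (u t).1) (hYu t),
    -- A constant diagonal factor conjugates the velocity, which preserves its zero diagonal.
    isGaugeFixedOn_of_matrix (Ω := fun t => D * frameOmega u t * star D) hYu hJ
      (contDiffOn_const.mul (contDiffOn_frameMatrix.2 hu.smooth)) (fun t ht => ?_)
      (fun t ht i => ?_), ?_, fun t => ?_⟩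
  · have e : D * (frameOmega u t * frameMatrix (u t).1)
        = D * frameOmega u t * star D * (D * frameMatrix (u t).1) := by
      rw [mul_assoc (D * _) (star D), ← mul_assoc (star D), mul_eq_one_comm.1 hDu, one_mul,
        mul_assoc D (frameOmega u t)]
    exact ((hasDerivAt_frameMatrix hJ hu.smooth ht).const_mul D).congr_deriv e
  · rw [← hDd.diagonal_diag, Matrix.star_eq_conjTranspose, Matrix.diagonal_conjTranspose,
      Matrix.mul_diagonal, Matrix.diagonal_mul, hu.frameOmega_diag hJ ht]
    simp
  · refine frameMatrix_injective ?_
    rw [frameMatrix_matrixFrame, hD, mul_assoc, star_mul_frameMatrix, mul_one]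
  · refine ((toFlag_eq_iff _ _).2 ?_).symm
    rw [frameMatrix_matrixFrame, mul_assoc, frameMatrix_mul_star, mul_one]
    exact hDd

theorem exists_primitive_contDiffOn {J : Set ℝ} (hJ : IsOpen J) (hJc : J.OrdConnected) {r : ℝ → ℝ}
    (hr : ContDiffOn ℝ ∞ r J) :
    ∃ θ : ℝ → ℝ, ContDiffOn ℝ ∞ θ J ∧ ∀ t ∈ J, HasDerivAt θ (r t) t := by
  rcases J.eq_empty_or_nonempty with rfl | ⟨t₀, ht₀⟩
  · exact ⟨0, by simp, by simp⟩
  have hd : ∀ t ∈ J, HasDerivAt (fun s => ∫ x in t₀..s, r x) (r t) t := fun t ht =>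
    intervalIntegral.integral_hasDerivAt_right
      ((hr.continuousOn.mono (hJc.uIcc_subset ht₀ ht)).intervalIntegrable)
      (hr.continuousOn.stronglyMeasurableAtFilter hJ t ht)
      (hr.continuousOn.continuousAt (hJ.mem_nhds ht))
  refine ⟨_, (contDiffOn_infty_iff_deriv_of_isOpen hJ).2
    ⟨fun t ht => (hd t ht).differentiableAt.differentiableWithinAt, ?_⟩, hd⟩
  exact hr.congr fun t ht => (hd t ht).deriv

/-- Every smooth curve of frames on an interval can be gauge-fixed. -/
theorem exists_isGaugeFixedOn {u : ℝ → UnitaryFrame} {J : Set ℝ} (hJ : IsOpen J)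
    (hJc : J.OrdConnected) (hu : ContDiffOn ℝ ∞ (fun t => (u t).1) J) :
    ∃ v : ℝ → UnitaryFrame, IsGaugeFixedOn v J ∧ ∀ t, (v t).toFlag = (u t).toFlag := by
  have hr : ∀ i, ContDiffOn ℝ ∞ (fun t => (frameOmega u t i i).im) J := fun i => by
    let e : CMat →L[ℝ] ℝ := LinearMap.toContinuousLinearMap
      { toFun := fun X => (X i i).im
        map_add' := fun _ _ => by simp
        map_smul' := fun _ _ => by simp }
    exact e.contDiff.comp_contDiffOn (contDiffOn_frameOmega hJ hu)
  choose θ hθ hθ' using fun i => exists_primitive_contDiffOn hJ hJc (hr i)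
  -- The diagonal velocities are purely imaginary; the phase exp(-iθ), with θ a primitive of their
  -- imaginary part, cancels them.
  set e : Fin 3 → ℝ → ℂ := fun i t => Complex.exp (-(θ i t * Complex.I)) with he
  have hee : ∀ i t, e i t * conj (e i t) = 1 := fun i t => by
    simp only [he]
    rw [← Complex.exp_conj, ← Complex.exp_add]
    simp
  let diagL : (Fin 3 → ℂ) →L[ℝ] CMat := LinearMap.toContinuousLinearMap
    { toFun := fun d => Matrix.diagonal d
      map_add' := fun _ _ => (Matrix.diagonal_add _ _).symm
      map_smul' := fun _ _ => (Matrix.diagonal_smul _ _) }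
  set D : ℝ → CMat := fun t => Matrix.diagonal fun i => e i t with hD
  have hDu : ∀ t, D t * star (D t) = 1 := fun t => by
    rw [hD, Matrix.star_eq_conjTranspose, Matrix.diagonal_conjTranspose,
      Matrix.diagonal_mul_diagonal, ← Matrix.diagonal_one]
    exact congrArg _ (funext fun i => hee i t)
  have hDs : ContDiffOn ℝ ∞ D J := diagL.contDiff.comp_contDiffOn (contDiffOn_pi.2 fun i =>
    Complex.contDiff_exp.comp_contDiffOn
      ((Complex.ofRealCLM.contDiff.comp_contDiffOn (hθ i)).mul contDiffOn_const).neg)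
  set K : ℝ → CMat := fun t =>
    Matrix.diagonal fun i => -(((frameOmega u t i i).im : ℂ) * Complex.I) with hK
  have hD' : ∀ t ∈ J, HasDerivAt D (K t * D t) t := fun t ht => by
    have h1 : HasDerivAt (fun s i => e i s)
        (fun i => -(((frameOmega u t i i).im : ℂ) * Complex.I) * e i t) t :=
      hasDerivAt_pi.2 fun i => by
        have := (((hθ' i t ht).ofReal_comp).mul_const Complex.I).neg.cexp
        exact this.congr_deriv (mul_comm _ _)
    have h2 : diagL (fun i => -(((frameOmega u t i i).im : ℂ) * Complex.I) * e i t)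
        = K t * D t := (Matrix.diagonal_mul_diagonal _ _).symm
    exact (diagL.hasFDerivAt.comp_hasDerivAt t h1).congr_deriv h2
  have hYu : ∀ t, D t * frameMatrix (u t).1 * star (D t * frameMatrix (u t).1) = 1 := fun t => by
    rw [star_mul, mul_assoc, ← mul_assoc (frameMatrix _), frameMatrix_mul_star, one_mul, hDu]
  refine ⟨fun t => matrixFrame (D t * frameMatrix (u t).1) (hYu t),
    isGaugeFixedOn_of_matrix (Ω := fun t => K t + D t * frameOmega u t * star (D t)) hYu hJ
      (hDs.mul (contDiffOn_frameMatrix.2 hu)) (fun t ht => ?_) (fun t ht i => ?_), fun t => ?_⟩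
  · have e : K t * D t * frameMatrix (u t).1 + D t * (frameOmega u t * frameMatrix (u t).1)
        = (K t + D t * frameOmega u t * star (D t)) * (D t * frameMatrix (u t).1) := by
      rw [add_mul, mul_assoc _ (star (D t)), ← mul_assoc (star (D t)),
        mul_eq_one_comm.1 (hDu t), one_mul, mul_assoc, mul_assoc]
    exact ((hD' t ht).mul (hasDerivAt_frameMatrix hJ hu ht)).congr_deriv e
  · have hre : (frameOmega u t i i).re = 0 := by
      have h1 := congrArg Complex.re (congrFun (congrFun (star_frameOmega hJ hu ht) i) i)
      rw [Matrix.star_apply, Matrix.neg_apply] at h1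
      simp at h1
      linarith
    have hKi : K t i i = -(((frameOmega u t i i).im : ℂ) * Complex.I) :=
      Matrix.diagonal_apply_eq _ i
    have hDi : (D t * frameOmega u t * star (D t)) i i
        = e i t * frameOmega u t i i * conj (e i t) := by
      rw [hD, Matrix.star_eq_conjTranspose, Matrix.diagonal_conjTranspose,
        Matrix.mul_diagonal, Matrix.diagonal_mul]
      rfl
    rw [Matrix.add_apply, hKi, hDi]
    have h2 := hee i t
    have h3 := Complex.re_add_im (frameOmega u t i i)
    rw [hre, Complex.ofReal_zero, zero_add] at h3
    rw [h3]
    linear_combination frameOmega u t i i * h2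
  · refine ((toFlag_eq_iff _ _).2 ?_).symm
    rw [frameMatrix_matrixFrame, mul_assoc, frameMatrix_mul_star, mul_one]
    exact Matrix.isDiag_diagonal _

theorem IsSmoothFlagCurveOn.exists_local_lift {c : ℝ → FlagManifold} {I : Set ℝ} (hI : IsOpen I)
    (hc : IsSmoothFlagCurveOn c I) {t₀ : ℝ} (ht₀ : t₀ ∈ I) :
    ∃ J : Set ℝ, IsOpen J ∧ J.OrdConnected ∧ t₀ ∈ J ∧ J ⊆ I ∧
      ∃ v : ℝ → UnitaryFrame, IsGaugeFixedOn v J ∧ ∀ t ∈ J, (v t).toFlag = c t := by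
  obtain ⟨J, hJ, htJ, u, hu, huc⟩ := hc t₀ ht₀
  obtain ⟨δ, hδ, hball⟩ := Metric.isOpen_iff.1 (hJ.inter hI) t₀ ⟨htJ, ht₀⟩
  rw [Real.ball_eq_Ioo] at hball
  obtain ⟨v, hv, hvu⟩ := exists_isGaugeFixedOn isOpen_Ioo ordConnected_Ioo (hu.mono hball)
  exact ⟨Ioo (t₀ - δ) (t₀ + δ), isOpen_Ioo, ordConnected_Ioo, ⟨by linarith, by linarith⟩,
    fun t ht => (hball ht).2, v, hv, fun t ht => (hvu t).trans (huc t (hball ht))⟩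

/-- A gauge-fixed lift of `c`, starting at `u₀`, on an open interval around `0`. -/
structure IsPartialLift (c : ℝ → FlagManifold) (u₀ : UnitaryFrame) (K : Set ℝ)
    (u : ℝ → UnitaryFrame) : Prop where
  isOpen : IsOpen K
  ordConnected : K.OrdConnected
  zero_mem : (0 : ℝ) ∈ K
  init : u 0 = u₀
  gauge : IsGaugeFixedOn u K
  lift : ∀ t ∈ K, (u t).toFlag = c t

theorem IsPartialLift.eqOn {c : ℝ → FlagManifold} {u₀ : UnitaryFrame} {K L : Set ℝ}
    {u v : ℝ → UnitaryFrame} (hu : IsPartialLift c u₀ K u) (hv : IsPartialLift c u₀ L v) :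
    EqOn u v (K ∩ L) :=
  (hu.gauge.mono inter_subset_left).eqOn (hu.isOpen.inter hv.isOpen)
    (hu.ordConnected.inter hv.ordConnected) (hv.gauge.mono inter_subset_right)
    (fun t ht => (hu.lift t ht.1).trans (hv.lift t ht.2).symm) ⟨hu.zero_mem, hv.zero_mem⟩
    (hu.init.trans hv.init.symm)

theorem IsPartialLift.union {c : ℝ → FlagManifold} {u₀ : UnitaryFrame} {K J : Set ℝ}
    {u v : ℝ → UnitaryFrame} (hu : IsPartialLift c u₀ K u) (hJ : IsOpen J) (hJc : J.OrdConnected)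
    (hv : IsGaugeFixedOn v J) (hvc : ∀ t ∈ J, (v t).toFlag = c t) {t₁ : ℝ} (ht₁ : t₁ ∈ K ∩ J)
    (h₁ : u t₁ = v t₁) : ∃ w, IsPartialLift c u₀ (K ∪ J) w := by
  classical
  have huv : EqOn u v (K ∩ J) :=
    (hu.gauge.mono inter_subset_left).eqOn (hu.isOpen.inter hJ) (hu.ordConnected.inter hJc)
      (hv.mono inter_subset_right) (fun t ht => (hu.lift t ht.1).trans (hvc t ht.2).symm) ht₁ h₁
  have hwK : EqOn (K.piecewise u v) u K := K.piecewise_eqOn u v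
  have hwJ : EqOn (K.piecewise u v) v J := fun t ht => by
    by_cases h : t ∈ K
    · exact (hwK h).trans (huv ⟨h, ht⟩)
    · exact K.piecewise_eq_of_notMem u v h
  refine ⟨K.piecewise u v, hu.isOpen.union hJ, ?_, Or.inl hu.zero_mem,
    (hwK hu.zero_mem).trans hu.init, isGaugeFixedOn_of_forall_nhds ?_, ?_⟩
  · exact (hu.ordConnected.isPreconnected.union t₁ ht₁.1 ht₁.2
      hJc.isPreconnected).ordConnected
  · rintro t (ht | ht)
    · exact ⟨K, hu.isOpen, ht, hu.gauge.congr hu.isOpen hwK⟩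
    · exact ⟨J, hJ, ht, hv.congr hJ hwJ⟩
  · rintro t (ht | ht)
    · rw [hwK ht, hu.lift t ht]
    · rw [hwJ ht, hvc t ht]

/-- Smooth curves in the flag manifold have gauge-fixed lifts. -/
theorem IsSmoothFlagCurveOn.exists_lift {c : ℝ → FlagManifold} {I : Set ℝ} (hI : IsOpen I)
    (hIc : I.OrdConnected) (hI0 : (0 : ℝ) ∈ I) (hc : IsSmoothFlagCurveOn c I) {u₀ : UnitaryFrame}
    (hu₀ : u₀.toFlag = c 0) :
    ∃ u : ℝ → UnitaryFrame, u 0 = u₀ ∧ IsGaugeFixedOn u I ∧ ∀ t ∈ I, (u t).toFlag = c t := by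
  classical
  -- The union of the domains of all partial lifts. Uniqueness glues them to one lift on S, so it
  -- remains to show that S exhausts the interval.
  set S : Set ℝ := {t | ∃ K u, IsPartialLift c u₀ K u ∧ t ∈ K} with hS
  have hsub : ∀ {K u}, IsPartialLift c u₀ K u → K ⊆ S := fun h t ht => ⟨_, _, h, ht⟩
  have hex : ∀ t, ∃ w : UnitaryFrame, ∀ K u, IsPartialLift c u₀ K u → t ∈ K → w = u t := by
    intro t
    by_cases h : t ∈ S
    · obtain ⟨K, u, hu, ht⟩ := h
      exact ⟨u t, fun L v hv htL => hu.eqOn hv ⟨ht, htL⟩⟩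
    -- Outside S the condition is void and the value is arbitrary.
    · exact ⟨u₀, fun K u hu ht => absurd (hsub hu ht) h⟩
  choose U hU using hex
  have hUK : ∀ {K u}, IsPartialLift c u₀ K u → EqOn U u K := fun h t ht => hU t _ _ h ht
  have h0 : ∃ K u, IsPartialLift c u₀ K u := by
    obtain ⟨J, hJ, hJc, h0J, -, v, hv, hvc⟩ := hc.exists_local_lift hI hI0
    obtain ⟨w, hw, hw0, hwv⟩ := hv.exists_rotate hJ ((hvc 0 h0J).trans hu₀.symm)
    exact ⟨J, w, hJ, hJc, h0J, hw0, hw, fun t ht => (hwv t).trans (hvc t ht)⟩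
  obtain ⟨K₀, u₁, hu₁⟩ := h0
  have hSU : IsPartialLift c u₀ S U := by
    refine ⟨?_, ?_, hsub hu₁ hu₁.zero_mem, (hUK hu₁ hu₁.zero_mem).trans hu₁.init,
      isGaugeFixedOn_of_forall_nhds ?_, ?_⟩
    · refine isOpen_iff_mem_nhds.2 ?_
      rintro t ⟨K, u, hu, ht⟩
      exact Filter.mem_of_superset (hu.isOpen.mem_nhds ht) (hsub hu)
    · refine (isPreconnected_of_forall (0 : ℝ) ?_).ordConnected
      rintro t ⟨K, u, hu, ht⟩
      exact ⟨K, hsub hu, hu.zero_mem, ht, hu.ordConnected.isPreconnected⟩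
    · rintro t ⟨K, u, hu, ht⟩
      exact ⟨K, hu.isOpen, ht, hu.gauge.congr hu.isOpen (hUK hu)⟩
    · rintro t ⟨K, u, hu, ht⟩
      rw [hUK hu ht, hu.lift t ht]
  have hIS : I ⊆ S := by
    -- By connectedness it is enough that S is open and relatively closed. Near a limit point of S a
    -- local lift meets S; rotated to agree with the glued lift at a common point, it extends it
    -- past the limit point.
    refine hIc.isPreconnected.subset_of_closure_inter_subset hSU.isOpen
      ⟨0, hI0, hSU.zero_mem⟩ ?_
    rintro t ⟨htS, htI⟩
    obtain ⟨J, hJ, hJc, htJ, -, v, hv, hvc⟩ := hc.exists_local_lift hI htI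
    obtain ⟨t₁, ht₁J, ht₁S⟩ := mem_closure_iff.1 htS J hJ htJ
    obtain ⟨w, hw, hwt, hwv⟩ :=
      hv.exists_rotate hJ ((hvc t₁ ht₁J).trans (hSU.lift t₁ ht₁S).symm)
    obtain ⟨x, hx⟩ := hSU.union hJ hJc hw (fun t ht => (hwv t).trans (hvc t ht)) ⟨ht₁S, ht₁J⟩
      hwt.symm
    exact hsub hx (Or.inr htJ)
  exact ⟨U, hSU.init, hSU.gauge.mono hIS, fun t ht => hSU.lift t (hIS ht)⟩

end Lifting

theorem proposition4 (α β : ℝ) (hα : 0 < α) (hβ : 0 < β)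
    (I : Set ℝ) (hIo : IsOpen I) (hIc : I.OrdConnected) (hI0 : (0 : ℝ) ∈ I) :
    -- every geodesic lifts, from any frame over its initial point, to a gauge-fixed curve of
    -- frames, and this curve is given by the formula
    (∀ c : ℝ → FlagManifold, IsFlagGeodesicOn α β β c I →
      ∀ u₀ : UnitaryFrame, u₀.toFlag = c 0 →
        ∃ u : ℝ → UnitaryFrame, u 0 = u₀ ∧ IsGaugeFixedOn u I ∧ (∀ t ∈ I, (u t).toFlag = c t) ∧
          ∀ t ∈ I, (u t).1 = geodesicFormula α β (frameVelocity u 1 0 0) (frameVelocity u 2 0 0)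
            (frameVelocity u 2 1 0) (u 0).1 t) ∧
    -- a gauge-fixed curve of frames represents a geodesic iff it is given by the formula
    (∀ u : ℝ → UnitaryFrame, IsGaugeFixedOn u I →
      (IsFlagGeodesicOn α β β (fun t => (u t).toFlag) I ↔
        ∀ t ∈ I, (u t).1 = geodesicFormula α β (frameVelocity u 1 0 0) (frameVelocity u 2 0 0)
          (frameVelocity u 2 1 0) (u 0).1 t)) ∧
    -- all initial data occur, and the corresponding solution is defined for all times
    (∀ (u₀ : UnitaryFrame) (a₂₁ a₃₁ a₃₂ : ℂ),
      ∃ u : ℝ → UnitaryFrame, u 0 = u₀ ∧ IsGaugeFixedOn u univ ∧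
        frameVelocity u 1 0 0 = a₂₁ ∧ frameVelocity u 2 0 0 = a₃₁ ∧ frameVelocity u 2 1 0 = a₃₂ ∧
        (∀ t, (u t).1 = geodesicFormula α β a₂₁ a₃₁ a₃₂ u₀.1 t) ∧
        IsFlagGeodesicOn α β β (fun t => (u t).toFlag) univ) := by
  refine ⟨fun c hc u₀ hu₀ => ?_, fun u hu => ⟨fun hg t ht => ?_, fun h => ?_⟩,
    exists_geodesic_of_initial_data hα.ne' hβ.ne'⟩
  · obtain ⟨u, hu0, hu, huc⟩ := hc.1.exists_lift hIo hIc hI0 hu₀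
    exact ⟨u, hu0, hu, huc, fun t ht =>
      hu.eq_geodesicFormula hα.ne' hβ.ne' hIo hIc hI0 huc hc ht⟩
  · exact hu.eq_geodesicFormula hα.ne' hβ.ne' hIo hIc hI0 (fun _ _ => rfl) hg ht
  · exact isFlagGeodesicOn_of_formula hα.ne' hβ.ne' hIo hu.smooth h
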